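/- **Conventions.** Let $\mathcal C$ be a small category with a Grothendieck topology. For a sheaf of groups $G$ on $\mathcal C$, a $G$-torsor is a sheaf of sets $X$ with a $G$-action for which there are an epimorphism of sheaves $U\twoheadrightarrow *$ onto the terminal sheaf and a $G$-equivariant isomorphism $X\times U\cong G\times U$ over $U$. $H^1(\mathcal C,G)$ is the set of isomorphism classes of $G$-torsors, pointed by the class of the trivial torsor $G$; a morphism $\varphi\colon G\to K$ of sheaves of groups induces $H^1(\mathcal C,G)\to H^1(\mathcal C,K)$, $[X]\mapsto[K\times^G X]$. For a discrete group $H$ let $\Gamma^*H$ be the associated constant sheaf of groups. For an object $Y$ of $\mathcal C$ put $H^1(X,H):=H^1(\mathcal C,\Gamma^*H)$ and $H^1(Y,H):=H^1(\mathcal C/Y,(\Gamma^*H)|_Y)$. For a group $\Gamma$, $H^1(\Gamma,H)$ is Serre's nonabelian cohomology set for the trivial action of $\Gamma$ on $H$ (1-cocycles modulo the cohomology relation, that is, homomorphisms $\Gamma\to H$ up to conjugation in $H$), pointed by the class of the trivial cocycle. A site is connected if, whenever its terminal sheaf is a coproduct of two sheaves, one of them is the initial sheaf. **Proposition.** Let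 $(\mathcal C,F)$ be a small Galois category with fibre functor $F$, equipped with a subcanonical Grothendieck topology in which the coprojections of every finite coproduct of $\mathcal C$ form a covering family (the empty coproduct included), and suppose that this site is connected. Let $Y$ be a connected Galois object of $\mathcal C$ such that $Y\to *$ is an epimorphism of sheaves, and let $G_Y=\mathrm{Aut}(Y)$. Then for every discrete group $H$ there is an exact sequence of pointed sets $$1\to H^1(G_Y,H)\to H^1(X,H)\to H^1(Y,H),$$ natural in $H$, in which the first map is injective and the second map is the restriction of torsors to $Y$. That is, both maps preserve base points, the first is injective, and its image is the set of classes whose restriction to $Y$ is trivial. -/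

import Mathlib

open CategoryTheory Opposite Limits

universe w u

noncomputable section

namespace NonabSite

instance : HasFilteredColimitsOfSize.{u, u} GrpCat.{u} where
  HasColimitsOfShape _ _ _ := ⟨fun F =>
    ⟨⟨⟨_, GrpCat.FilteredColimits.colimitCoconeIsColimit.{u, u} F⟩⟩⟩⟩

section Sites

variable {C : Type u} [SmallCategory C] {J : GrothendieckTopology C}

/-- A sheaf of sets is connected if in every decomposition as a coproduct of two sheaves, one of
the two summands is the initial sheaf. -/
def IsConnectedSheaf (F : Sheaf J (Type u)) : Prop :=
  ∀ (F₁ F₂ : Sheaf J (Type u)) (i₁ : F₁ ⟶ F) (i₂ : F₂ ⟶ F),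
    Nonempty (IsColimit (BinaryCofan.mk i₁ i₂)) →
      Nonempty (IsInitial F₁) ∨ Nonempty (IsInitial F₂)

variable (J) in
/-- A site is connected if its terminal sheaf is connected. -/
def IsConnectedSite : Prop := IsConnectedSheaf (⊤_ (Sheaf J (Type u)))

variable (J) in
/-- The coprojections of every finite coproduct of `C` form a covering family. For the empty
coproduct, this says that an initial object is covered by the empty family. -/
def FiniteCoproductsCover : Prop :=
  ∀ (ι : Type) [Finite ι] (X : ι → C) (c : Cofan X), Nonempty (IsColimit c) →
    Sieve.ofArrows X c.inj ∈ J c.pt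

variable (J) in
/-- The constant sheaf of groups `Γ^* H` of a discrete group `H`. -/
abbrev constGrp (H : Type u) [Group H] : Sheaf J GrpCat.{u} :=
  (constantSheaf J GrpCat.{u}).obj (GrpCat.of H)

variable (J) in
/-- The morphism of constant sheaves of groups induced by a group homomorphism. -/
abbrev constGrpMap {H K : Type u} [Group H] [Group K] (φ : H →* K) :
    constGrp J H ⟶ constGrp J K :=
  (constantSheaf J GrpCat.{u}).map (GrpCat.ofHom φ)

/-- A sheaf of sets with a left action of a sheaf of groups `G`. -/
structure GSheaf (G : Sheaf J GrpCat.{u}) where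
  carrier : Sheaf J (Type u)
  smul : ∀ V : Cᵒᵖ, G.obj.obj V → carrier.obj.obj V → carrier.obj.obj V
  one_smul : ∀ (V : Cᵒᵖ) (x : carrier.obj.obj V), smul V 1 x = x
  mul_smul : ∀ (V : Cᵒᵖ) (g h : G.obj.obj V) (x : carrier.obj.obj V),
    smul V (g * h) x = smul V g (smul V h x)
  map_smul : ∀ {V W : Cᵒᵖ} (f : V ⟶ W) (g : G.obj.obj V) (x : carrier.obj.obj V),
    carrier.obj.map f (smul V g x) = smul W (G.obj.map f g) (carrier.obj.map f x)

namespace GSheaf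

variable {G G' : Sheaf J GrpCat.{u}}

/-- An equivariant map of sheaves. -/
@[ext]
structure Hom (X Y : GSheaf G) where
  hom : X.carrier ⟶ Y.carrier
  map_smul : ∀ (V : Cᵒᵖ) (g : G.obj.obj V) (x : X.carrier.obj.obj V),
    hom.hom.app V (X.smul V g x) = Y.smul V g (hom.hom.app V x)

instance : Category (GSheaf G) where
  Hom := Hom
  id X := ⟨𝟙 _, fun _ _ _ => rfl⟩
  comp f g := ⟨f.hom ≫ g.hom, fun V a x => by
    change g.hom.hom.app V (f.hom.hom.app V _) = _
    rw [f.map_smul, g.map_smul]; rfl⟩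
  id_comp f := Hom.ext (Category.id_comp _)
  comp_id f := Hom.ext (Category.comp_id _)
  assoc f g h := Hom.ext (Category.assoc _ _ _)

/-- A trivialization of `X` along a sheaf `U`: a `G`-equivariant isomorphism of sheaves
`X × U ≅ G × U` over `U`, given on sections (products of sheaves are computed sectionwise). -/
structure Trivialization (X : GSheaf G) (U : Sheaf J (Type u)) where
  equiv : ∀ V : Cᵒᵖ, X.carrier.obj.obj V × U.obj.obj V ≃ G.obj.obj V × U.obj.obj V
  snd_equiv : ∀ (V : Cᵒᵖ) (x : X.carrier.obj.obj V) (t : U.obj.obj V), (equiv V (x, t)).2 = t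
  equiv_smul : ∀ (V : Cᵒᵖ) (g : G.obj.obj V) (x : X.carrier.obj.obj V) (t : U.obj.obj V),
    equiv V (X.smul V g x, t) = (g * (equiv V (x, t)).1, t)
  equiv_map : ∀ {V W : Cᵒᵖ} (f : V ⟶ W) (x : X.carrier.obj.obj V) (t : U.obj.obj V),
    equiv W (X.carrier.obj.map f x, U.obj.map f t) =
      (G.obj.map f (equiv V (x, t)).1, U.obj.map f t)

/-- `X` is a `G`-torsor if it is trivialized along some sheaf `U` with `U → *` an epimorphism. -/
def IsTorsor : ObjectProperty (GSheaf G) := fun X =>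
  ∃ U : Sheaf J (Type u), Epi (terminal.from U) ∧ Nonempty (X.Trivialization U)

end GSheaf

/-- The category of torsors under a sheaf of groups `G` and equivariant maps. -/
abbrev SheafTorsor (G : Sheaf J GrpCat.{u}) := (GSheaf.IsTorsor (G := G)).FullSubcategory

/-- Nonabelian `H¹` of the site with coefficients in `G`: isomorphism classes of `G`-torsors. -/
def H1 (G : Sheaf J GrpCat.{u}) : Type (u + 1) := Quotient (isIsomorphicSetoid (SheafTorsor G))

/-! ### The trivial torsor -/

/-- The sheaf of groups `G` acting on itself by left translations. -/
def GSheaf.trivial (G : Sheaf J GrpCat.{u}) : GSheaf G where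
  carrier := (sheafCompose J (forget GrpCat.{u})).obj G
  smul V := fun (g x : G.obj.obj V) => g * x
  one_smul V := fun (x : G.obj.obj V) => one_mul x
  mul_smul V := fun (g h x : G.obj.obj V) => mul_assoc g h x
  map_smul {V _} f := fun (g x : G.obj.obj V) => map_mul (G.obj.map f).hom g x

theorem GSheaf.trivial_isTorsor (G : Sheaf J GrpCat.{u}) : IsTorsor (GSheaf.trivial G) :=
  ⟨⊤_ _, by rw [Subsingleton.elim (terminal.from _) (𝟙 (⊤_ Sheaf J (Type u)))]; infer_instance,
    ⟨{ equiv := fun V => Equiv.refl _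
       snd_equiv := fun _ _ _ => rfl
       equiv_smul := fun _ _ _ _ => rfl
       equiv_map := fun _ _ _ => rfl }⟩⟩

/-- The base point of `H¹`: the class of the trivial torsor. -/
def H1.base (G : Sheaf J GrpCat.{u}) : H1 G :=
  Quotient.mk _ ⟨GSheaf.trivial G, GSheaf.trivial_isTorsor G⟩

/-! ### Restriction to `C/Y` -/

theorem epi_terminal_iff (U : Sheaf J (Type u)) : Epi (terminal.from U) ↔
    ∀ V : C, ∃ S ∈ J V, ∀ ⦃W : C⦄ (f : W ⟶ V), S f → Nonempty (U.obj.obj (op W)) := by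
  rw [← Sheaf.isLocallySurjective_iff_epi]
  constructor
  · intro h V
    have h' : Presheaf.IsLocallySurjective J (terminal.from U).hom := h
    let s : (⊤_ (Sheaf J (Type u))).obj.obj (op V) :=
      (terminal.from (Sheaf.terminal J Types.isTerminalPUnit)).hom.app (op V) PUnit.unit
    exact ⟨_, h'.imageSieve_mem s, fun W f hf => ⟨hf.choose⟩⟩
  · intro h
    refine (⟨fun {V} s => ?_⟩ : Presheaf.IsLocallySurjective J (terminal.from U).hom)
    obtain ⟨S, hS, hU⟩ := h V
    refine J.superset_covering (fun W f hf => ?_) hS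
    obtain ⟨t⟩ := hU f hf
    refine ⟨t, ?_⟩
    have key : ∀ a b : (⊤_ (Sheaf J (Type u))).obj.obj (op W), a = b := by
      let i : (⊤_ (Sheaf J (Type u))) ≅ Sheaf.terminal J Types.isTerminalPUnit :=
        terminalIsTerminal.uniqueUpToIso (Sheaf.isTerminalTerminal J Types.isTerminalPUnit)
      let j := ((sheafToPresheaf J _).mapIso i).app (op W)
      exact fun a b => j.toEquiv.injective (Subsingleton.elim (α := PUnit) _ _)
    exact key _ _

theorem epi_terminal_over {U : Sheaf J (Type u)} (hU : Epi (terminal.from U)) (Y : C) :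
    Epi (terminal.from (U.over Y)) := by
  rw [epi_terminal_iff] at hU ⊢
  intro V
  obtain ⟨S, hS, h⟩ := hU V.left
  exact ⟨_, J.overEquiv_symm_mem_over V S hS,
    fun W f hf => h f.left ((Sieve.overEquiv_symm_iff _ _).1 hf)⟩

/-- The restriction to the site `C/Y` of a sheaf with an action of `G`. -/
def GSheaf.restrict {G : Sheaf J GrpCat.{u}} (X : GSheaf G) (Y : C) : GSheaf (G.over Y) where
  carrier := X.carrier.over Y
  smul V g x := X.smul (op V.unop.left) g x
  one_smul _ x := X.one_smul _ x
  mul_smul _ g h x := X.mul_smul _ g h x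
  map_smul f g x := X.map_smul ((Over.forget Y).op.map f) g x

theorem GSheaf.restrict_isTorsor {G : Sheaf J GrpCat.{u}} {X : GSheaf G} (hX : IsTorsor X)
    (Y : C) : IsTorsor (X.restrict Y) := by
  obtain ⟨U, hU, ⟨t⟩⟩ := hX
  exact ⟨U.over Y, epi_terminal_over hU Y,
    ⟨{ equiv := fun V => t.equiv (op V.unop.left)
       snd_equiv := fun V x s => t.snd_equiv _ x s
       equiv_smul := fun V g x s => t.equiv_smul _ g x s
       equiv_map := fun f x s => t.equiv_map ((Over.forget Y).op.map f) x s }⟩⟩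

/-- The restriction functor from `G`-torsors on `C` to `G|_Y`-torsors on `C/Y`. -/
def SheafTorsor.restrict (G : Sheaf J GrpCat.{u}) (Y : C) :
    SheafTorsor G ⥤ SheafTorsor (G.over Y) where
  obj P := ⟨P.obj.restrict Y, GSheaf.restrict_isTorsor P.property Y⟩
  map {P Q} f := ObjectProperty.homMk
    (show P.obj.restrict Y ⟶ Q.obj.restrict Y from
      ⟨(J.overPullback (Type u) Y).map f.hom.hom, fun V g x =>
        f.hom.map_smul (op V.unop.left) g x⟩)

/-- The restriction map `H¹(C, G) → H¹(C/Y, G|_Y)`. -/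
def H1.restrict (G : Sheaf J GrpCat.{u}) (Y : C) : H1 G → H1 (G.over Y) :=
  Quotient.map (SheafTorsor.restrict G Y).obj
    fun _ _ ⟨e⟩ => ⟨(SheafTorsor.restrict G Y).mapIso e⟩

/-! ### Change of the group -/

section Push

variable {G K : Sheaf J GrpCat.{u}} (φ : G ⟶ K)

/-- The presheaf whose sections over `V` are the maps `X|_V → K|_V` of sheaves of sets. -/
abbrev homToGrp (X : GSheaf G) (K : Sheaf J GrpCat.{u}) : Cᵒᵖ ⥤ Type u :=
  presheafHom X.carrier.obj ((sheafCompose J (forget GrpCat.{u})).obj K).obj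

/-- The value of a map `X|_V → K|_V` at a section of `X` over `W → V`. -/
def homToGrp.eval {X : GSheaf G} {V : Cᵒᵖ} (s : (homToGrp X K).obj V) (W : Over V.unop)
    (x : X.carrier.obj.obj (op W.left)) : K.obj.obj (op W.left) := s.app (op W) x

theorem homToGrp.eval_map {X : GSheaf G} {V : Cᵒᵖ} (s : (homToGrp X K).obj V)
    {W W' : Over V.unop} (f : W' ⟶ W) (x : X.carrier.obj.obj (op W.left)) :
    homToGrp.eval s W' (X.carrier.obj.map f.left.op x) =
      K.obj.map f.left.op (homToGrp.eval s W x) :=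
  NatTrans.naturality_apply s f.op x

theorem homToGrp.ext {X : GSheaf G} {V : Cᵒᵖ} {s s' : (homToGrp X K).obj V}
    (h : ∀ W x, homToGrp.eval s W x = homToGrp.eval s' W x) : s = s' :=
  NatTrans.ext (funext fun W => ConcreteCategory.hom_ext _ _ fun x => h W.unop x)

/-- The map `X|_V → K|_V` with prescribed values. -/
def homToGrp.mk {X : GSheaf G} {V : Cᵒᵖ}
    (v : ∀ W : Over V.unop, X.carrier.obj.obj (op W.left) → K.obj.obj (op W.left))
    (hv : ∀ {W W' : Over V.unop} (f : W' ⟶ W) (x : X.carrier.obj.obj (op W.left)),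
      v W' (X.carrier.obj.map f.left.op x) = K.obj.map f.left.op (v W x)) :
    (homToGrp X K).obj V where
  app W := TypeCat.ofHom (v W.unop)
  naturality _ _ f := ConcreteCategory.hom_ext _ _ fun x => hv f.unop x

/-- The sections over `V` of `K ×^G X`, for `X` a `G`-torsor: a class `[k, x]`
(where `[k φ(g), x] = [k, g x]`) is identified with the map `X|_V → K|_V` sending `g x` to
`k φ(g)⁻¹`. So the sections are the maps `s` with `s (g x) = s x * φ(g)⁻¹`. -/
def pushSub (X : GSheaf G) : Subfunctor (homToGrp X K) where
  obj V := {s | ∀ (W : Over V.unop) (g : G.obj.obj (op W.left))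
    (x : X.carrier.obj.obj (op W.left)),
    homToGrp.eval s W (X.smul _ g x) = homToGrp.eval s W x * (φ.hom.app _ g)⁻¹}
  map f _ hs W g x := hs ((Over.map f.unop).obj W) g x

theorem pushSub_isSheaf (X : GSheaf G) : Presheaf.IsSheaf J (pushSub φ X).toFunctor := by
  have hK := ((sheafCompose J (forget GrpCat.{u})).obj K).property
  have hH := Presheaf.IsSheaf.hom X.carrier.obj _ hK
  rw [isSheaf_iff_isSheaf_of_type] at hH hK ⊢
  rw [Subfunctor.isSheaf_iff _ hH]
  intro V s hs W g x
  refine (hK _ (J.pullback_stable W.hom hs)).isSeparatedFor.ext fun Z f hf => ?_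
  have h1 := hf (Over.mk (𝟙 Z)) (G.obj.map f.op g) (X.carrier.obj.map f.op x)
  have h2 : ∀ y : X.carrier.obj.obj (op Z),
      homToGrp.eval ((homToGrp X K).map (f ≫ W.hom).op s) (Over.mk (𝟙 Z)) y =
        homToGrp.eval s (Over.mk (f ≫ W.hom)) y := fun y =>
    ConcreteCategory.congr_hom (presheafHom_map_app_op_mk_id (f ≫ W.hom) s) y
  have h3 : ∀ y : X.carrier.obj.obj (op W.left),
      homToGrp.eval s (Over.mk (f ≫ W.hom)) (X.carrier.obj.map f.op y) =
        K.obj.map f.op (homToGrp.eval s W y) :=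
    fun y => homToGrp.eval_map s (Over.homMk f : Over.mk (f ≫ W.hom) ⟶ W) y
  have h4 : (φ.hom.app (op Z)) (G.obj.map f.op g) = K.obj.map f.op (φ.hom.app _ g) :=
    NatTrans.naturality_apply φ.hom f.op g
  change homToGrp.eval ((homToGrp X K).map (f ≫ W.hom).op s) (Over.mk (𝟙 Z))
    (X.smul (op Z) (G.obj.map f.op g) (X.carrier.obj.map f.op x)) =
    HMul.hMul (α := K.obj.obj (op Z)) (β := K.obj.obj (op Z))
      (homToGrp.eval ((homToGrp X K).map (f ≫ W.hom).op s) (Over.mk (𝟙 Z))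
        (X.carrier.obj.map f.op x)) (φ.hom.app (op Z) (G.obj.map f.op g))⁻¹ at h1
  rw [h2, h2, ← X.map_smul, h3, h3, h4] at h1
  change K.obj.map f.op _ = K.obj.map f.op _
  rw [map_mul, map_inv]
  exact h1

/-- The pushforward `K ×^G X` of a `G`-torsor `X`, with `k' [k, x] = [k' k, x]`. -/
def GSheaf.push (X : GSheaf G) : GSheaf K where
  carrier := ⟨(pushSub φ X).toFunctor, pushSub_isSheaf φ X⟩
  smul V k s := ⟨homToGrp.mk (fun W x => K.obj.map W.hom.op k * homToGrp.eval s.1 W x)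
      fun {W W'} f x => by
        rw [homToGrp.eval_map, map_mul, ← ConcreteCategory.comp_apply, ← K.obj.map_comp,
          ← op_comp, Over.w],
    fun W g x => by
      change _ * homToGrp.eval s.1 W (X.smul _ g x) = _ * homToGrp.eval s.1 W x * _
      rw [s.2 W g x, mul_assoc]⟩
  one_smul V s := Subtype.ext (homToGrp.ext fun W x => by
    change K.obj.map W.hom.op 1 * homToGrp.eval s.1 W x = _
    rw [map_one, one_mul])
  mul_smul V g h s := Subtype.ext (homToGrp.ext fun W x => by
    change K.obj.map W.hom.op (g * h) * homToGrp.eval s.1 W x =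
      K.obj.map W.hom.op g * (K.obj.map W.hom.op h * homToGrp.eval s.1 W x)
    rw [map_mul, mul_assoc])
  map_smul {V V'} f g s := Subtype.ext (homToGrp.ext fun W x => by
    change K.obj.map (W.hom ≫ f.unop).op g * _ = K.obj.map W.hom.op (K.obj.map f g) * _
    rw [op_comp, K.obj.map_comp, ConcreteCategory.comp_apply]
    rfl)

/-- An equivariant map `X' → X` induces `K ×^G X → K ×^G X'` by composition (for torsors this is
the inverse of the map induced by functoriality of the contracted product). -/
def GSheaf.pushMap {X X' : GSheaf G} (f : X' ⟶ X) : X.push φ ⟶ X'.push φ where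
  hom := ObjectProperty.homMk
    { app := fun V => TypeCat.ofHom fun s => ⟨homToGrp.mk
          (fun W x => homToGrp.eval s.1 W (f.hom.hom.app _ x))
          (fun {W W'} g x => by
            rw [NatTrans.naturality_apply f.hom.hom, homToGrp.eval_map]),
        fun W g x => by
          change homToGrp.eval s.1 W (f.hom.hom.app _ (X'.smul _ g x)) = _
          rw [f.map_smul, s.2 W]
          rfl⟩
      naturality := fun V V' g => rfl }
  map_smul V g s := rfl

theorem GSheaf.push_isTorsor {X : GSheaf G} (hX : IsTorsor X) : IsTorsor (X.push φ) := by
  obtain ⟨U, hU, ⟨t⟩⟩ := hX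
  have hinj : ∀ {V} (a : X.carrier.obj.obj V) (b : U.obj.obj V),
      t.equiv V (a, b) = ((t.equiv V (a, b)).1, b) := fun a b => Prod.ext rfl (t.snd_equiv _ a b)
  -- the section of `X` over `U` given by the trivialization
  let p : ∀ V, U.obj.obj V → X.carrier.obj.obj V := fun V b => ((t.equiv V).symm (1, b)).1
  have hp : ∀ V b, t.equiv V (p V b, b) = (1, b) := fun V b => by
    have h := (t.equiv V).apply_symm_apply (1, b)
    have h2 : ((t.equiv V).symm (1, b)).2 = b := by
      have := t.snd_equiv V ((t.equiv V).symm (1, b)).1 ((t.equiv V).symm (1, b)).2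
      rw [Prod.mk.eta, h] at this
      exact this.symm
    have h3 : (t.equiv V).symm (1, b) = (p V b, b) := Prod.ext rfl h2
    rw [← h3, h]
  have hx : ∀ V (x : X.carrier.obj.obj V) (b : U.obj.obj V),
      X.smul V (t.equiv V (x, b)).1 (p V b) = x := fun V x b => by
    have : t.equiv V (X.smul V (t.equiv V (x, b)).1 (p V b), b) = t.equiv V (x, b) := by
      rw [t.equiv_smul, hp, mul_one, ← hinj]
    exact congrArg Prod.fst ((t.equiv V).injective this)
  have hpm : ∀ {V W : Cᵒᵖ} (f : V ⟶ W) (b : U.obj.obj V),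
      p W (U.obj.map f b) = X.carrier.obj.map f (p V b) := fun {V W} f b => by
    have : t.equiv W (p W (U.obj.map f b), U.obj.map f b) =
        t.equiv W (X.carrier.obj.map f (p V b), U.obj.map f b) := by
      rw [hp, t.equiv_map, hp, map_one]
    exact congrArg Prod.fst ((t.equiv W).injective this)
  refine ⟨U, hU, ⟨
    { equiv := fun V =>
        { toFun := fun q => (homToGrp.eval q.1.1 (Over.mk (𝟙 V.unop)) (p V q.2), q.2)
          invFun := fun q => (⟨homToGrp.mk
            (fun W x => K.obj.map W.hom.op q.1 *
              (φ.hom.app _ (t.equiv _ (x, U.obj.map W.hom.op q.2)).1)⁻¹)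
            (fun {W W'} f x => ?_), fun W g x => ?_⟩, q.2)
          left_inv := fun q => Prod.ext (Subtype.ext (homToGrp.ext fun W x => ?_)) rfl
          right_inv := fun q => Prod.ext ?_ rfl }
      snd_equiv := fun _ _ _ => rfl
      equiv_smul := fun V g x b => Prod.ext ?_ rfl
      equiv_map := fun {V V'} f x b => Prod.ext ?_ rfl }⟩⟩
  · have h1 : U.obj.map W'.hom.op q.2 = U.obj.map f.left.op (U.obj.map W.hom.op q.2) := by
      rw [← ConcreteCategory.comp_apply, ← U.obj.map_comp, ← op_comp, Over.w]
    have h2 : K.obj.map W'.hom.op q.1 = K.obj.map f.left.op (K.obj.map W.hom.op q.1) := by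
      rw [← ConcreteCategory.comp_apply, ← K.obj.map_comp, ← op_comp, Over.w]
    rw [h1, t.equiv_map, map_mul, map_inv, h2, NatTrans.naturality_apply φ.hom]
  · change K.obj.map W.hom.op q.1 * (φ.hom.app _ (t.equiv _ (X.smul _ g x, _)).1)⁻¹ =
      K.obj.map W.hom.op q.1 * (φ.hom.app _ (t.equiv _ (x, _)).1)⁻¹ * (φ.hom.app _ g)⁻¹
    rw [t.equiv_smul, map_mul, mul_inv_rev, mul_assoc]
  · obtain ⟨s, b⟩ := q
    change K.obj.map W.hom.op (homToGrp.eval s.1 (Over.mk (𝟙 V.unop)) (p V b)) *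
      (φ.hom.app _ (t.equiv _ (x, U.obj.map W.hom.op b)).1)⁻¹ = homToGrp.eval s.1 W x
    have h1 := homToGrp.eval_map s.1 (Over.homMk W.hom (Category.comp_id _) : W ⟶ Over.mk (𝟙 V.unop)) (p V b)
    change homToGrp.eval s.1 W (X.carrier.obj.map W.hom.op (p V b)) =
      K.obj.map W.hom.op (homToGrp.eval s.1 (Over.mk (𝟙 V.unop)) (p V b)) at h1
    rw [← h1, ← hpm, ← s.2 W, hx]
  · change K.obj.map (𝟙 V) q.1 *
      (φ.hom.app _ (t.equiv V (p V q.2, U.obj.map (𝟙 V) q.2)).1)⁻¹ = q.1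
    have h1 : U.obj.map (𝟙 V) q.2 = q.2 := by rw [U.obj.map_id]; rfl
    have h2 : K.obj.map (𝟙 V) q.1 = q.1 := by rw [K.obj.map_id]; rfl
    rw [h1, h2, hp, map_one, inv_one, mul_one]
  · change K.obj.map (𝟙 V) g * _ = g * _
    have h2 : K.obj.map (𝟙 V) g = g := by rw [K.obj.map_id]; rfl
    rw [h2]
    rfl
  · change homToGrp.eval x.1 ((Over.map f.unop).obj (Over.mk (𝟙 V'.unop)))
      (p V' (U.obj.map f b)) = K.obj.map f (homToGrp.eval x.1 (Over.mk (𝟙 V.unop)) (p V b))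
    rw [hpm]
    exact homToGrp.eval_map x.1 (Over.homMk f.unop ((Category.comp_id _).trans
      (Category.id_comp _).symm) :
      (Over.map f.unop).obj (Over.mk (𝟙 V'.unop)) ⟶ Over.mk (𝟙 V.unop)) (p V b)

theorem GSheaf.pushMap_comp_pushMap {X X' : GSheaf G} (f : X' ⟶ X) (g : X ⟶ X')
    (h : g ≫ f = 𝟙 X) : pushMap φ f ≫ pushMap φ g = 𝟙 _ := by
  refine Hom.ext (ObjectProperty.hom_ext _ (NatTrans.ext (funext fun V =>
    ConcreteCategory.hom_ext _ _ fun s => Subtype.ext (homToGrp.ext fun W x => ?_))))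
  change homToGrp.eval s.1 W ((g ≫ f).hom.hom.app _ x) = homToGrp.eval s.1 W x
  rw [h]
  rfl

/-- The map `H¹(C, G) → H¹(C, K)` induced by `φ : G ⟶ K`. -/
def H1.map : H1 G → H1 K :=
  Quotient.map (fun P : SheafTorsor G => (⟨P.obj.push φ, GSheaf.push_isTorsor φ P.property⟩ :
      SheafTorsor K))
    fun _ _ ⟨e⟩ => ⟨
      { hom := ObjectProperty.homMk (GSheaf.pushMap φ e.inv.hom)
        inv := ObjectProperty.homMk (GSheaf.pushMap φ e.hom.hom)
        hom_inv_id := ObjectProperty.hom_ext _ (GSheaf.pushMap_comp_pushMap φ _ _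
          (congrArg (fun f => f.hom) e.hom_inv_id))
        inv_hom_id := ObjectProperty.hom_ext _ (GSheaf.pushMap_comp_pushMap φ _ _
          (congrArg (fun f => f.hom) e.inv_hom_id)) }⟩

end Push

end Sites

/-! ### Nonabelian cohomology of groups -/

section Groups

variable {G A B : Type u} [Group G] [Group A] [Group B]

/-- `1`-cocycles of a group `G` acting on a group `A` through `ρ`. -/
def GroupCocycle (ρ : G →* MulAut A) : Type u :=
  {a : G → A // ∀ s t, a (s * t) = a s * ρ s (a t)}

/-- Two cocycles `a`, `a'` are cohomologous if `a' s = b⁻¹ * a s * (s • b)` for some `b`. -/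
def groupCohomologous (ρ : G →* MulAut A) : Setoid (GroupCocycle ρ) where
  r a a' := ∃ b : A, ∀ s, a'.1 s = b⁻¹ * a.1 s * ρ s b
  iseqv :=
    { refl := fun a => ⟨1, fun s => by simp⟩
      symm := by
        rintro a a' ⟨b, h⟩
        exact ⟨b⁻¹, fun s => by simp [h, mul_assoc]⟩
      trans := by
        rintro a a' a'' ⟨b, h⟩ ⟨b', h'⟩
        exact ⟨b * b', fun s => by simp [h, h', mul_assoc]⟩ }

/-- The nonabelian cohomology set `H¹(G, A)` of Serre, for the action `ρ` of `G` on `A`. -/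
def GroupH1 (ρ : G →* MulAut A) : Type u := Quotient (groupCohomologous ρ)

/-- The base point of `H¹(G, A)`: the class of the constant cocycle `1`. -/
def GroupH1.base (ρ : G →* MulAut A) : GroupH1 ρ :=
  Quotient.mk _ ⟨fun _ => 1, fun _ _ => by simp⟩

/-- The map `H¹(G, A) → H¹(G, B)` induced by an equivariant homomorphism `φ : A →* B`. -/
def GroupH1.map {ρ : G →* MulAut A} {σ : G →* MulAut B} (φ : A →* B)
    (hφ : ∀ s a, φ (ρ s a) = σ s (φ a)) : GroupH1 ρ → GroupH1 σ :=
  Quotient.map (fun a => ⟨fun s => φ (a.1 s), fun s t => by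
      simpa [hφ] using congrArg φ (a.2 s t)⟩)
    fun _ _ ⟨b, h⟩ => ⟨φ b, fun s => by
      change φ _ = _
      rw [h, map_mul, map_mul, map_inv, hφ]⟩

end Groups

end NonabSite

end

/-! Everything rests on the relation `GSheaf.IsTwist`: the torsor X has a section p over Y with σ^*p
= θ(σ)p for all automorphisms σ of Y. The first map sends a homomorphism θ to the class of the
torsors twisted by θ.

Such torsors exist. As Y is Galois and covers the terminal sheaf, it is a torsor under the constant
sheaf of Aut Y, with its identity as a section twisted by the identity homomorphism
(`exists_isTorsor_isTwist_id`); pushing it forward along θ gives a torsor twisted by θ. They form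
one class: g·y^*p ↦ g·y^*p' descends to an isomorphism (`GSheaf.IsTwist.nonempty_hom`). So the class
does not depend on the torsor chosen, and naturality in H amounts to the effect of a pushforward on
twists.

The main point is that the sections of the constant sheaf over Y are exactly H. Injectivity holds
because Y is not covered by the empty sieve; surjectivity (`constSection_surjective`) uses the
connectedness of the site. Given this, any two sections of a torsor over Y differ by a constant b,
which conjugates θ by b; this is injectivity. A torsor restricts trivially to Y exactly when it has
a section p over Y, and then σ^*p = θ(σ)p defines a homomorphism θ with values in H; this is
exactness. -/

noncomputable section

namespace NonabSite

/-! ### Local reasoning on a site and gluing of sections -/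

section LocalArguments

variable {C : Type u} [SmallCategory C] {J : GrothendieckTopology C}

variable (J) in
/-- The property `p` of morphisms to `V` holds on a covering sieve of `V`. -/
def HoldsLocally {V : C} (p : ∀ ⦃W : C⦄, (W ⟶ V) → Prop) : Prop :=
  ∃ S ∈ J V, ∀ ⦃W : C⦄ (f : W ⟶ V), S f → p f

namespace HoldsLocally

variable {V : C} {p q : ∀ ⦃W : C⦄, (W ⟶ V) → Prop}

theorem of_forall (h : ∀ ⦃W : C⦄ (f : W ⟶ V), p f) : HoldsLocally J p :=
  ⟨⊤, J.top_mem V, fun _ f _ => h f⟩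

theorem mono (hp : HoldsLocally J p) (h : ∀ ⦃W : C⦄ (f : W ⟶ V), p f → q f) :
    HoldsLocally J q := by
  obtain ⟨S, hS, hp⟩ := hp
  exact ⟨S, hS, fun _ f hf => h f (hp f hf)⟩

theorem bind (hp : HoldsLocally J p)
    (h : ∀ ⦃W : C⦄ (f : W ⟶ V), p f → HoldsLocally J fun _ g => q (g ≫ f)) :
    HoldsLocally J q := by
  obtain ⟨S, hS, hp⟩ := hp
  choose T hT hq using fun (W : C) (f : W ⟶ V) (hf : S f) => h f (hp f hf)
  refine ⟨Sieve.bind S fun W f hf => T W f hf, J.bind_covering hS fun W f hf => hT W f hf, ?_⟩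
  rintro W _ ⟨Z, g, f, hf, hg, rfl⟩
  exact hq Z f hf g hg

theorem pullback (hp : HoldsLocally J p) {W : C} (f : W ⟶ V) :
    HoldsLocally J fun W' (g : W' ⟶ W) => p (g ≫ f) := by
  obtain ⟨S, hS, hp⟩ := hp
  exact ⟨S.pullback f, J.pullback_stable f hS, fun _ g hg => hp _ hg⟩

theorem and (hp : HoldsLocally J p) (hq : HoldsLocally J q) :
    HoldsLocally J fun _ f => p f ∧ q f := by
  obtain ⟨S, hS, hp⟩ := hp
  obtain ⟨T, hT, hq⟩ := hq
  exact ⟨S ⊓ T, J.intersection_covering hS hT, fun _ f hf => ⟨hp f hf.1, hq f hf.2⟩⟩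

/-- Covering sieves are stable under finite intersections. It serves to make all translates of a
section by the finite group Aut Y constant on one cover. -/
theorem finite_forall {ι : Type*} [Finite ι] {r : ι → ∀ ⦃W : C⦄, (W ⟶ V) → Prop}
    (h : ∀ i, HoldsLocally J (r i)) : HoldsLocally J fun _ f => ∀ i, r i f := by
  classical
  have := Fintype.ofFinite ι
  have key : ∀ s : Finset ι, HoldsLocally J fun _ f => ∀ i ∈ s, r i f := by
    intro s
    induction s using Finset.induction_on with
    | empty => exact of_forall fun _ _ _ hi => absurd hi (Finset.notMem_empty _)
    | insert i s _ ih =>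
      exact ((h i).and ih).mono fun _ f hf j hj =>
        (Finset.mem_insert.1 hj).elim (fun e => e ▸ hf.1) (hf.2 j)
  exact (key Finset.univ).mono fun _ f hf i => hf i (Finset.mem_univ i)

end HoldsLocally

theorem bot_mem_of_hom {V W : C} (f : W ⟶ V) (h : ⊥ ∈ J V) : ⊥ ∈ J W := by
  simpa using J.pullback_stable f h

theorem bot_mem_of_holdsLocally {V : C}
    (h : HoldsLocally J fun W (_ : W ⟶ V) => ⊥ ∈ J W) : ⊥ ∈ J V := by
  obtain ⟨S, hS, h⟩ := h
  exact J.transitive hS _ fun W f hf => by simpa using h f hf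

theorem holdsLocally_of_bot_mem {V : C} {p : ∀ ⦃W : C⦄, (W ⟶ V) → Prop} (h : ⊥ ∈ J V) :
    HoldsLocally J p :=
  ⟨⊥, h, fun _ _ hf => hf.elim⟩

theorem Sheaf.eq_of_locally_eq (Z : Sheaf J (Type u)) {V : C} {z z' : Z.obj.obj (op V)}
    (h : HoldsLocally J fun _ f => Z.obj.map f.op z = Z.obj.map f.op z') : z = z' := by
  obtain ⟨S, hS, h⟩ := h
  exact (((isSheaf_iff_isSheaf_of_type J Z.obj).1 Z.property) S hS).isSeparatedFor.ext h

/-- Sections of a sheaf can be glued from a relation which is stable under restriction and which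
locally singles out exactly one section. -/
theorem Sheaf.exists_glue (Z : Sheaf J (Type u)) {V : C}
    (R : ∀ ⦃W : C⦄, (W ⟶ V) → Z.obj.obj (op W) → Prop)
    (hres : ∀ ⦃W : C⦄ (f : W ⟶ V) (z : Z.obj.obj (op W)), R f z →
      ∀ ⦃W' : C⦄ (g : W' ⟶ W), R (g ≫ f) (Z.obj.map g.op z))
    (huniq : ∀ ⦃W : C⦄ (f : W ⟶ V) (z z' : Z.obj.obj (op W)), R f z → R f z' → z = z')
    (hloc : HoldsLocally J fun _ f => ∃ z, R f z) :
    ∃ z : Z.obj.obj (op V), ∀ ⦃W : C⦄ (f : W ⟶ V) (z' : Z.obj.obj (op W)), R f z' →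
      Z.obj.map f.op z = z' := by
  -- The sieve of all arrows over which R is solvable. Solutions are picked by choice; their
  -- uniqueness makes the family compatible.
  let S : Sieve V :=
    { arrows := fun W f => ∃ z, R f z
      downward_closed := fun ⟨z, hz⟩ g => ⟨_, hres _ z hz g⟩ }
  have hS : S ∈ J V := by
    obtain ⟨T, hT, h⟩ := hloc
    exact J.superset_covering (fun W f hf => h f hf) hT
  have hZ := ((isSheaf_iff_isSheaf_of_type J Z.obj).1 Z.property) S hS
  let x : Presieve.FamilyOfElements Z.obj S.arrows := fun W f hf => Classical.choose hf
  have hx : ∀ ⦃W : C⦄ (f : W ⟶ V) (hf : S f), R f (x f hf) :=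
    fun W f hf => Classical.choose_spec hf
  have hc : x.Compatible := by
    intro W₁ W₂ Z' g₁ g₂ f₁ f₂ h₁ h₂ e
    refine huniq (g₁ ≫ f₁) _ _ (hres _ _ (hx f₁ h₁) g₁) ?_
    rw [e]
    exact hres _ _ (hx f₂ h₂) g₂
  refine ⟨hZ.amalgamate x hc, fun W f z' hz' => ?_⟩
  rw [hZ.valid_glue hc f ⟨z', hz'⟩]
  exact huniq f _ _ (hx f _) hz'

theorem Sheaf.eq_of_locally_eq_grp (G : Sheaf J GrpCat.{u}) {V : C} {g g' : G.obj.obj (op V)}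
    (h : HoldsLocally J fun _ f => G.obj.map f.op g = G.obj.map f.op g') : g = g' :=
  Sheaf.eq_of_locally_eq ((sheafCompose J (forget GrpCat.{u})).obj G) h

theorem Sheaf.exists_glue_grp (G : Sheaf J GrpCat.{u}) {V : C}
    (R : ∀ ⦃W : C⦄, (W ⟶ V) → G.obj.obj (op W) → Prop)
    (hres : ∀ ⦃W : C⦄ (f : W ⟶ V) (z : G.obj.obj (op W)), R f z →
      ∀ ⦃W' : C⦄ (g : W' ⟶ W), R (g ≫ f) (G.obj.map g.op z))
    (huniq : ∀ ⦃W : C⦄ (f : W ⟶ V) (z z' : G.obj.obj (op W)), R f z → R f z' → z = z')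
    (hloc : HoldsLocally J fun _ f => ∃ z, R f z) :
    ∃ z : G.obj.obj (op V), ∀ ⦃W : C⦄ (f : W ⟶ V) (z' : G.obj.obj (op W)), R f z' →
      G.obj.map f.op z = z' :=
  Sheaf.exists_glue ((sheafCompose J (forget GrpCat.{u})).obj G) R hres huniq hloc

/-! ### Connected sites -/

/-- The subsheaf of the terminal sheaf defined by a local property of objects. -/
def subterminal (P : C → Prop) (hP : ∀ ⦃V W : C⦄, (W ⟶ V) → P V → P W)
    (hloc : ∀ V : C, (HoldsLocally J fun W (_ : W ⟶ V) => P W) → P V) : Sheaf J (Type u) where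
  obj :=
    { obj := fun V => {_x : PUnit.{u + 1} // P V.unop}
      map := fun f => TypeCat.ofHom fun x => ⟨x.1, hP f.unop x.2⟩ }
  property := by
    rw [isSheaf_iff_isSheaf_of_type]
    intro V S hS x hx
    exact ⟨⟨PUnit.unit, hloc V ⟨S, hS, fun W f hf => (x f hf).2⟩⟩,
      fun W f hf => Subsingleton.elim _ _, fun y hy => Subsingleton.elim _ _⟩

/-- The objects covered by the empty sieve define a subsheaf of the terminal sheaf, and the initial
sheaf maps to it. -/
theorem bot_mem_of_isInitial {Z : Sheaf J (Type u)} (hZ : IsInitial Z) {V : C}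
    (z : Z.obj.obj (op V)) : ⊥ ∈ J V :=
  ((hZ.to (subterminal (fun V => ⊥ ∈ J V) (fun _ _ f => bot_mem_of_hom f)
    fun _ => bot_mem_of_holdsLocally)).hom.app (op V) z).2

/-- On a connected site, if two disjoint local properties of objects cover the terminal sheaf, then
one of them holds only for objects covered by the empty sieve. -/
theorem IsConnectedSite.disjoint_cover (h : IsConnectedSite J) (P Q : C → Prop)
    (hP : ∀ ⦃V W : C⦄, (W ⟶ V) → P V → P W)
    (hPloc : ∀ V : C, (HoldsLocally J fun W (_ : W ⟶ V) => P W) → P V)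
    (hQ : ∀ ⦃V W : C⦄, (W ⟶ V) → Q V → Q W)
    (hQloc : ∀ V : C, (HoldsLocally J fun W (_ : W ⟶ V) => Q W) → Q V)
    (hdisj : ∀ V : C, P V → Q V → ⊥ ∈ J V)
    (hcov : ∀ V : C, HoldsLocally J fun W (_ : W ⟶ V) => P W ∨ Q W) :
    (∀ V : C, P V → ⊥ ∈ J V) ∨ (∀ V : C, Q V → ⊥ ∈ J V) := by
  let A := subterminal P hP hPloc
  let B := subterminal Q hQ hQloc
  -- This makes the terminal sheaf the coproduct of A and B: two maps to Z prescribe sections where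
  -- P or Q holds. Where both hold the empty sieve covers, so Z has at most one section and no
  -- compatibility is needed.
  have glue : ∀ (Z : Sheaf J (Type u)) (f₁ : A ⟶ Z) (f₂ : B ⟶ Z) (V : C),
      ∃! z : Z.obj.obj (op V), ∀ ⦃W : C⦄ (f : W ⟶ V),
        (∀ h, Z.obj.map f.op z = f₁.hom.app (op W) ⟨PUnit.unit, h⟩) ∧
          (∀ h, Z.obj.map f.op z = f₂.hom.app (op W) ⟨PUnit.unit, h⟩) := by
    intro Z f₁ f₂ V
    obtain ⟨z, hz⟩ := Sheaf.exists_glue Z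
      (fun W (f : W ⟶ V) z => (∃ h, z = f₁.hom.app (op W) ⟨PUnit.unit, h⟩) ∨
        (∃ h, z = f₂.hom.app (op W) ⟨PUnit.unit, h⟩))
      (fun W f z hz W' g => by
        rcases hz with ⟨h, rfl⟩ | ⟨h, rfl⟩
        · exact Or.inl ⟨hP g h, (NatTrans.naturality_apply f₁.hom g.op _).symm⟩
        · exact Or.inr ⟨hQ g h, (NatTrans.naturality_apply f₂.hom g.op _).symm⟩)
      (fun W f z z' hz hz' => by
        rcases hz with ⟨h, rfl⟩ | ⟨h, rfl⟩ <;> rcases hz' with ⟨h', rfl⟩ | ⟨h', rfl⟩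
        · rfl
        · exact Sheaf.eq_of_locally_eq Z (holdsLocally_of_bot_mem (hdisj W h h'))
        · exact Sheaf.eq_of_locally_eq Z (holdsLocally_of_bot_mem (hdisj W h' h))
        · rfl)
      ((hcov V).mono fun W f hW => hW.elim (fun h => ⟨_, Or.inl ⟨h, rfl⟩⟩)
        fun h => ⟨_, Or.inr ⟨h, rfl⟩⟩)
    refine ⟨z, fun W f => ⟨fun h => hz f _ (Or.inl ⟨h, rfl⟩), fun h => hz f _ (Or.inr ⟨h, rfl⟩)⟩,
      fun z' hz' => Sheaf.eq_of_locally_eq Z ((hcov V).mono fun W f hW => ?_)⟩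
    rcases hW with h | h
    · rw [(hz' f).1 h, hz f _ (Or.inl ⟨h, rfl⟩)]
    · rw [(hz' f).2 h, hz f _ (Or.inr ⟨h, rfl⟩)]
  have hcolim : Nonempty (IsColimit (BinaryCofan.mk (terminal.from A) (terminal.from B))) := by
    choose z hz hz' using glue
    have hzmap : ∀ Z f₁ f₂ ⦃V W : C⦄ (g : W ⟶ V),
        Z.obj.map g.op (z Z f₁ f₂ V) = z Z f₁ f₂ W := fun Z f₁ f₂ V W g =>
      hz' Z f₁ f₂ W _ fun W' f => by
        have := hz Z f₁ f₂ V (f ≫ g)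
        simp only [op_comp, Functor.map_comp_apply] at this
        exact this
    refine ⟨BinaryCofan.IsColimit.mk _ (fun {Z} f₁ f₂ => ObjectProperty.homMk
      { app := fun V => TypeCat.ofHom fun _ => z Z f₁ f₂ V.unop
        naturality := fun V W g => ConcreteCategory.hom_ext _ _ fun _ =>
          (hzmap Z f₁ f₂ g.unop).symm }) ?_ ?_ ?_⟩
    · intro Z f₁ f₂
      refine ObjectProperty.hom_ext _ (NatTrans.ext (funext fun V =>
        ConcreteCategory.hom_ext _ _ fun x => ?_))
      have := (hz Z f₁ f₂ V.unop (𝟙 _)).1 x.2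
      exact (Functor.map_id_apply Z.obj _ _).symm.trans this
    · intro Z f₁ f₂
      refine ObjectProperty.hom_ext _ (NatTrans.ext (funext fun V =>
        ConcreteCategory.hom_ext _ _ fun x => ?_))
      have := (hz Z f₁ f₂ V.unop (𝟙 _)).2 x.2
      exact (Functor.map_id_apply Z.obj _ _).symm.trans this
    · intro Z f₁ f₂ m h₁ h₂
      refine ObjectProperty.hom_ext _ (NatTrans.ext (funext fun V =>
        ConcreteCategory.hom_ext _ _ fun x => ?_))
      refine hz' Z f₁ f₂ V.unop _ fun W f => ?_
      have hT : ∀ t t' : (⊤_ (Sheaf J (Type u))).obj.obj (op W), t = t' := by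
        let i : (⊤_ (Sheaf J (Type u))) ≅ Sheaf.terminal J Types.isTerminalPUnit :=
          terminalIsTerminal.uniqueUpToIso (Sheaf.isTerminalTerminal J Types.isTerminalPUnit)
        let j := ((sheafToPresheaf J _).mapIso i).app (op W)
        exact fun a b => j.toEquiv.injective (Subsingleton.elim (α := PUnit) _ _)
      have e : Z.obj.map f.op (m.hom.app V x) = m.hom.app (op W)
          ((⊤_ (Sheaf J (Type u))).obj.map f.op x) :=
        (NatTrans.naturality_apply m.hom f.op x).symm
      refine ⟨fun h => ?_, fun h => ?_⟩
      · refine e.trans ((congrArg _ (hT _ ((terminal.from A).hom.app (op W)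
          ⟨PUnit.unit, h⟩))).trans ?_)
        rw [← h₁]
        rfl
      · refine e.trans ((congrArg _ (hT _ ((terminal.from B).hom.app (op W)
          ⟨PUnit.unit, h⟩))).trans ?_)
        rw [← h₂]
        rfl
  rcases h A B _ _ hcolim with hA | hB
  · exact Or.inl fun V hV => bot_mem_of_isInitial hA.some (V := V)
      (⟨PUnit.unit, hV⟩ : {_x : PUnit.{u + 1} // P V})
  · exact Or.inr fun V hV => bot_mem_of_isInitial hB.some (V := V)
      (⟨PUnit.unit, hV⟩ : {_x : PUnit.{u + 1} // Q V})

/-! ### Constant sheaves of groups -/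

section Const

variable {H K : Type u} [Group H] [Group K]

variable (J) in
/-- The section of the constant sheaf of groups defined by an element of the group. -/
def constSection (V : Cᵒᵖ) : H →* (constGrp J H).obj.obj V :=
  ((toSheafify J ((Functor.const Cᵒᵖ).obj (GrpCat.of H))).app V).hom

theorem map_constSection {V W : Cᵒᵖ} (f : V ⟶ W) (h : H) :
    (constGrp J H).obj.map f (constSection J V h) = constSection J W h :=
  (NatTrans.naturality_apply (toSheafify J ((Functor.const Cᵒᵖ).obj (GrpCat.of H))) f h).symm

theorem constGrpMap_constSection (φ : H →* K) (V : Cᵒᵖ) (h : H) :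
    (constGrpMap J φ).hom.app V (constSection J V h) = constSection J V (φ h) := by
  have := toSheafify_naturality J ((Functor.const Cᵒᵖ).map (GrpCat.ofHom φ))
  exact (ConcreteCategory.congr_hom (NatTrans.congr_app this V) h).symm

/-- Sheafification is locally surjective. -/
theorem locally_constSection {V : C} (s : (constGrp J H).obj.obj (op V)) :
    HoldsLocally J fun W f => ∃ h : H, (constGrp J H).obj.map f.op s = constSection J (op W) h := by
  refine ⟨_, Presheaf.imageSieve_mem J (toSheafify J ((Functor.const Cᵒᵖ).obj (GrpCat.of H))) s,
    fun W f hf => ?_⟩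
  obtain ⟨h, e⟩ := hf
  exact ⟨h, e.symm⟩

/-- Sheafification is locally injective, and distinct elements of the constant presheaf agree over
no object, so their equalizer sieve is empty. -/
theorem bot_mem_of_constSection_eq {V : C} {h h' : H} (hne : h ≠ h')
    (e : constSection J (op V) h = constSection J (op V) h') : ⊥ ∈ J V := by
  refine J.superset_covering ?_ (Presheaf.equalizerSieve_mem J
    (toSheafify J ((Functor.const Cᵒᵖ).obj (GrpCat.of H))) h h' e)
  intro W f hf
  exact hne hf

end Const

end LocalArguments

/-! ### Galois objects: local transitivity and quotients -/

section Galois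

open PreGaloisCategory

variable {C : Type u} [SmallCategory C] [GaloisCategory C]
  {J : GrothendieckTopology C}

/-- Two morphisms to a Galois object differ, locally on the source, by an automorphism. -/
theorem locally_eq_comp_aut (F : C ⥤ FintypeCat.{w}) [FiberFunctor F]
    (hcop : FiniteCoproductsCover J) (Y : C) [IsGalois Y] {V : C}
    (y y' : V ⟶ Y) : HoldsLocally J fun _ f => ∃ σ : Aut Y, f ≫ y' = f ≫ y ≫ σ.hom := by
  -- V is the coproduct of the equalizers of y' and y ≫ σ, one for each σ. `FiniteCoproductsCover`
  -- speaks of index sets in `Type`, hence the passage to `Fin n`.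
  obtain ⟨n, ⟨e⟩⟩ := Finite.exists_equiv_fin (Aut Y)
  let X : Fin n → C := fun i => equalizer y' (y ≫ (e.symm i).hom)
  let p : ∀ i, X i ⟶ V := fun i => equalizer.ι _ _
  have hF : ∀ c : Cofan X, ∀ hc : IsColimit c, ∀ z : F.obj c.pt,
      ∃ i, ∃ x : F.obj (X i), F.map (c.inj i) x = z := by
    intro c hc z
    obtain ⟨⟨i⟩, x, hx⟩ := Types.jointly_surjective_of_isColimit
      (isColimitOfPreserves (F ⋙ FintypeCat.incl) hc) z
    exact ⟨i, x, hx⟩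
  have hiso : IsIso (Limits.Sigma.desc p) := by
    -- On fibres: Aut Y acts freely on F(Y), so the pieces are disjoint, and transitively, so they
    -- exhaust F(V).
    have : IsIso (F.map (Sigma.desc p)) := by
      rw [ConcreteCategory.isIso_iff_bijective]
      constructor
      · intro z₁ z₂ h
        obtain ⟨i₁, x₁, rfl⟩ := hF _ (coproductIsCoproduct X) z₁
        obtain ⟨i₂, x₂, rfl⟩ := hF _ (coproductIsCoproduct X) z₂
        have hp : ∀ i (x : F.obj (X i)), F.map (Sigma.desc p) (F.map (Sigma.ι X i) x) =
            F.map (p i) x := fun i x => by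
          rw [← ConcreteCategory.comp_apply, ← F.map_comp, Sigma.ι_desc]
        have h' : F.map (p i₁) x₁ = F.map (p i₂) x₂ := by
          rw [← hp, ← hp]
          exact h
        have hy : ∀ i (x : F.obj (X i)), F.map y' (F.map (p i) x) =
            F.map (e.symm i).hom (F.map y (F.map (p i) x)) := fun i x => by
          simp only [← ConcreteCategory.comp_apply, ← F.map_comp]
          rw [equalizer.condition, Category.assoc]
        have hi : i₁ = i₂ := by
          have h1 := hy i₁ x₁
          rw [h', hy] at h1
          exact (e.symm.injective (evaluation_aut_injective_of_isConnected F Y _ h1)).symm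
        subst hi
        have hinj : Function.Injective (F.map (p i₁)) :=
          ConcreteCategory.injective_of_mono_of_preservesPullback _
        rw [hinj h']
      · intro v
        obtain ⟨σ, hσ⟩ := evaluation_aut_surjective_of_isGalois F Y (F.map y v) (F.map y' v)
        let x : F.obj (X (e σ)) := (fiberEqualizerEquiv F _ _).symm
          ⟨v, by rw [F.map_comp, ConcreteCategory.comp_apply, e.symm_apply_apply]; exact hσ.symm⟩
        refine ⟨F.map (Sigma.ι X (e σ)) x, ?_⟩
        rw [← ConcreteCategory.comp_apply, ← F.map_comp, Sigma.ι_desc]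
        exact fiberEqualizerEquiv_symm_ι_apply F _ _
    exact isIso_of_reflects_iso (Sigma.desc p) F
  let i : ∐ X ≅ V := asIso (Limits.Sigma.desc p)
  have hc : IsColimit (Cofan.mk V p) :=
    IsColimit.ofIsoColimit (coproductIsCoproduct X) (Cofan.ext i fun j => Sigma.ι_desc p j)
  refine ⟨_, hcop (Fin n) X (Cofan.mk V p) ⟨hc⟩, ?_⟩
  rintro W _ ⟨_, a, _, ⟨i⟩, rfl⟩
  refine ⟨e.symm i, ?_⟩
  rw [Category.assoc, Category.assoc]
  exact congrArg (a ≫ ·) (equalizer.condition _ _)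

/-- Let `Y → Q` be the quotient of a Galois object by a subgroup `S` of its automorphism group. If
`Q` has a global section, then `S` is the whole group. -/
theorem eq_top_of_section (F : C ⥤ FintypeCat.{w}) [FiberFunctor F]
    (Y : C) [IsGalois Y] (S : Subgroup (Aut Y))
    (e : ⊤_ C ⟶ colimit (SingleObj.functor ((Aut.toEnd Y).comp S.subtype))) : S = ⊤ := by
  let D := SingleObj.functor ((Aut.toEnd Y).comp S.subtype)
  let q : Y ⟶ colimit D := colimit.ι D (SingleObj.star S)
  have hq : Epi q := ⟨fun a b h => colimit.hom_ext fun _ => h⟩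
  obtain ⟨t⟩ : Nonempty (F.obj (⊤_ C)) := by
    obtain ⟨y⟩ := nonempty_fiber_of_isConnected F Y
    exact ⟨F.map (terminal.from Y) y⟩
  obtain ⟨y, hy⟩ := surjective_on_fiber_of_epi F q (F.map e t)
  -- The pullback of the section is a subobject of the connected object Y with nonempty fibre, hence
  -- all of Y; so q factors through the terminal object and identifies all automorphisms.
  have hiso : IsIso (pullback.fst q e) := IsConnected.noTrivialComponent _ (pullback.fst q e)
    ((not_initial_iff_fiber_nonempty F _).2 ⟨(fiberPullbackEquiv F q e).symm ⟨(y, t), hy⟩⟩)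
  have hfac : q = terminal.from Y ≫ e := by
    rw [← cancel_epi (pullback.fst q e), pullback.condition, ← Category.assoc]
    exact congrArg (· ≫ e) (Subsingleton.elim _ _)
  rw [eq_top_iff]
  intro σ _
  have h : F.map q (F.map σ.hom y) = F.map q y := by
    have hσ : σ.hom ≫ q = q := by
      rw [hfac, ← Category.assoc]
      exact congrArg (· ≫ e) (Subsingleton.elim _ _)
    rw [← ConcreteCategory.comp_apply, ← F.map_comp, hσ]
  -- The fibre functor preserves the quotient by the finite group S, so points of F(Y) with the same
  -- image lie in one S-orbit. The cocone `c` of orbits detects this; freeness of the action then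
  -- gives σ = τ.
  have hS : ∃ τ : S, F.map τ.1.hom y = F.map σ.hom y := by
    have hc := isColimitOfPreserves (F ⋙ FintypeCat.incl) (colimit.isColimit D)
    let D' := D ⋙ F ⋙ FintypeCat.incl
    let c : Cocone D' :=
      { pt := MulAction.orbitRel.Quotient S (D'.obj (SingleObj.star S))
        ι :=
          { app := fun _ => TypeCat.ofHom fun x => Quotient.mk _ x
            naturality := fun _ _ g => ConcreteCategory.hom_ext _ _ fun x =>
              Quotient.sound (s := MulAction.orbitRel S _) ⟨g, rfl⟩ } }
    have h1 := fun x : F.obj Y => ConcreteCategory.congr_hom (hc.fac c (SingleObj.star S)) x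
    have h2 := (h1 (F.map σ.hom y)).symm.trans ((congrArg (hc.desc c) h).trans (h1 y))
    obtain ⟨τ, hτ⟩ := Quotient.exact h2
    exact ⟨τ, hτ⟩
  obtain ⟨τ, hτ⟩ := hS
  rw [← evaluation_aut_injective_of_isConnected F Y y hτ]
  exact τ.2

end Galois

/-! ### Sections of constant sheaves over a Galois object -/

section ConstAtGalois

open PreGaloisCategory

variable {C : Type u} [SmallCategory C] {J : GrothendieckTopology C}

/-- For a subcanonical topology, an object covered by the empty sieve is initial. -/
def isInitialOfBotMem [J.Subcanonical] {Y : C} (h : ⊥ ∈ J Y) : IsInitial Y :=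
  have hex : ∀ Z : C, Nonempty (Y ⟶ Z) := fun Z => by
    obtain ⟨z, _⟩ := Sheaf.exists_glue (J.yoneda.obj Z) (V := Y) (fun _ _ _ => False)
      (fun _ _ _ h => h.elim) (fun _ _ _ _ h => h.elim) (holdsLocally_of_bot_mem h)
    exact ⟨z⟩
  IsInitial.ofUniqueHom (fun Z => (hex Z).some) fun Z m =>
    Sheaf.eq_of_locally_eq (J.yoneda.obj Z) (V := Y) (holdsLocally_of_bot_mem h)

/-- Otherwise Y would be initial, which a connected object is not. -/
theorem bot_notMem_of_isConnected [J.Subcanonical] (Y : C) [PreGaloisCategory.IsConnected Y] :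
    ⊥ ∉ J Y :=
  fun h => IsConnected.notInitial (isInitialOfBotMem h)

theorem constSection_injective [J.Subcanonical] (Y : C) [PreGaloisCategory.IsConnected Y]
    {H : Type u} [Group H] : Function.Injective (constSection J (H := H) (op Y)) :=
  fun _ _ e => by_contra fun hne =>
    bot_notMem_of_isConnected (J := J) Y (bot_mem_of_constSection_eq hne e)

theorem locally_nonempty_hom [J.Subcanonical] {Y : C}
    (hY : Epi (terminal.from (J.yoneda.obj Y))) (V : C) :
    HoldsLocally J fun W (_ : W ⟶ V) => Nonempty (W ⟶ Y) :=
  (epi_terminal_iff _).1 hY V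

/-- A Galois object of a connected site which covers the terminal sheaf is connected as a sheaf:
the sections over it of a constant sheaf are constant. -/
theorem constSection_surjective [GaloisCategory C] (F : C ⥤ FintypeCat.{w}) [FiberFunctor F]
    [J.Subcanonical] (hcop : FiniteCoproductsCover J) (hconn : IsConnectedSite J)
    (Y : C) [IsGalois Y] (hY : Epi (terminal.from (J.yoneda.obj Y))) {H : Type u} [Group H] :
    Function.Surjective (constSection J (H := H) (op Y)) := by
  intro s
  let X := constGrp J H
  -- the twists of `s` along `y` are constant with values `a`
  let U : (Aut Y → H) → ∀ {V : C}, (V ⟶ Y) → Prop := fun a V y =>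
    ∀ σ : Aut Y, X.obj.map (y ≫ σ.hom).op s = constSection J (op V) (a σ)
  have hUres : ∀ {a : Aut Y → H} {V W : C} {y : V ⟶ Y} (f : W ⟶ V), U a y → U a (f ≫ y) := by
    intro a V W y f h σ
    rw [Category.assoc, op_comp, Functor.map_comp_apply, h σ, map_constSection]
  have hUloc : ∀ {V : C} (y : V ⟶ Y), HoldsLocally J fun _ f => ∃ a, U a (f ≫ y) := by
    intro V y
    refine (HoldsLocally.finite_forall fun σ : Aut Y =>
      locally_constSection (X.obj.map (y ≫ σ.hom).op s)).mono fun W f hf => ?_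
    choose a ha using hf
    refine ⟨a, fun σ => ?_⟩
    rw [← ha σ, ← Functor.map_comp_apply, ← op_comp, Category.assoc]
  -- Replacing y by y ≫ τ translates the function of values on the right by τ, so only its orbit is
  -- intrinsic to an object V not covered by the empty sieve.
  have hUaut : ∀ {a b : Aut Y → H} {V : C} {y : V ⟶ Y} (τ : Aut Y), U a (y ≫ τ.hom) → U b y →
      (∀ σ, a σ = b (σ * τ)) ∨ ⊥ ∈ J V := by
    intro a b V y τ ha hb
    by_contra! hne
    obtain ⟨⟨σ, hσ⟩, hV⟩ := hne
    refine hV (bot_mem_of_constSection_eq hσ ?_)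
    rw [← ha, ← hb, Category.assoc]
    rfl
  have hUaut' : ∀ {a : Aut Y → H} {V : C} {y : V ⟶ Y} (τ : Aut Y), U a y →
      U (fun σ => a (σ * τ)) (y ≫ τ.hom) := by
    intro a V y τ ha σ
    rw [← ha, Category.assoc]
    rfl
  have hYne := bot_notMem_of_isConnected (J := J) Y
  obtain ⟨a, V₀, y₀, hV₀, hU₀⟩ : ∃ (a : Aut Y → H) (V : C) (y : V ⟶ Y), ⊥ ∉ J V ∧ U a y := by
    by_contra! hne
    refine hYne (bot_mem_of_holdsLocally ((hUloc (𝟙 Y)).mono fun W f hf => ?_))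
    obtain ⟨a, ha⟩ := hf
    by_contra hW
    exact hne a W _ hW ha
  -- P and Q say that the orbit of `a` occurs locally, respectively nowhere. They split the terminal
  -- sheaf; since `a` occurs over V₀, connectedness of the site forces P everywhere.
  let P : C → Prop := fun V => HoldsLocally J fun W (_ : W ⟶ V) => ∃ y : W ⟶ Y, U a y
  let Q : C → Prop := fun V => ∀ ⦃W : C⦄, (W ⟶ V) → ∀ y : W ⟶ Y, U a y → ⊥ ∈ J W
  have hcov : ∀ V : C, HoldsLocally J fun W (_ : W ⟶ V) => P W ∨ Q W := by
    intro V
    refine (locally_nonempty_hom hY V).bind fun W f ⟨y⟩ => (hUloc y).mono fun W' g hg => ?_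
    obtain ⟨b, hb⟩ := hg
    by_cases h : ∃ τ : Aut Y, ∀ σ, a σ = b (σ * τ)
    · obtain ⟨τ, hτ⟩ := h
      obtain rfl : a = fun σ => b (σ * τ) := funext hτ
      exact Or.inl (HoldsLocally.of_forall fun Z k => ⟨_, hUres k (hUaut' τ hb)⟩)
    · refine Or.inr fun Z k y' hy' => bot_mem_of_holdsLocally ?_
      refine (locally_eq_comp_aut F hcop Y (k ≫ g ≫ y) y').mono fun Z' l ⟨τ, hτ⟩ => ?_
      have h1 := hUres l hy'
      rw [hτ, ← Category.assoc] at h1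
      exact (hUaut τ h1 (hUres l (hUres k hb))).resolve_left fun h' => h ⟨τ, h'⟩
  have hP : ∀ V : C, P V := by
    have key := hconn.disjoint_cover P Q (fun V W f h => h.pullback f)
      (fun V h => h.bind fun W f hW => hW)
      (fun V W f h Z k => h (k ≫ f))
      (fun V h W f y hy => bot_mem_of_holdsLocally ((h.pullback f).mono fun W' g hg =>
        hg (𝟙 W') (g ≫ y) (hUres g hy)))
      (fun V hV hV' => bot_mem_of_holdsLocally (hV.mono fun W f ⟨y, hy⟩ => hV' f y hy))
      hcov
    rcases key with key | key
    · exact absurd (key V₀ (HoldsLocally.of_forall fun W f => ⟨f ≫ y₀, hUres f hU₀⟩)) hV₀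
    · exact fun V => (hcov V).bind fun W f hW =>
        hW.elim id fun h => holdsLocally_of_bot_mem (key W h)
  -- The stabilizer of `a`: the local maps y with values `a` are unique up to S, so their images in
  -- Y/S glue to a global section. Subcanonicity makes it a morphism of C, and `eq_top_of_section`
  -- shows that `a` is constant.
  let S : Subgroup (Aut Y) :=
    { carrier := {τ | ∀ σ, a σ = a (σ * τ)}
      one_mem' := fun σ => by rw [mul_one]
      mul_mem' := fun {τ τ'} h h' σ => by rw [← mul_assoc, ← h', ← h]
      inv_mem' := fun {τ} h σ => by rw [h (σ * τ⁻¹), inv_mul_cancel_right] }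
  let D := SingleObj.functor ((Aut.toEnd Y).comp S.subtype)
  let q : Y ⟶ colimit D := colimit.ι D (SingleObj.star S)
  have hq : ∀ τ ∈ S, τ.hom ≫ q = q := fun τ hτ =>
    colimit.w D (j := SingleObj.star S) (j' := SingleObj.star S) (⟨τ, hτ⟩ : S)
  obtain ⟨e, -⟩ := Sheaf.exists_glue (J.yoneda.obj (colimit D)) (V := ⊤_ C)
    (fun W _ z => ∃ y : W ⟶ Y, U a y ∧ z = y ≫ q)
    (by
      rintro W f _ ⟨y, hy, rfl⟩ W' g
      exact ⟨g ≫ y, hUres g hy, (Category.assoc _ _ _).symm⟩)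
    (by
      rintro W f _ _ ⟨y, hy, rfl⟩ ⟨y', hy', rfl⟩
      refine Sheaf.eq_of_locally_eq (J.yoneda.obj (colimit D))
        ((locally_eq_comp_aut F hcop Y y y').bind fun W' g ⟨τ, hτ⟩ => ?_)
      have h1 := hUres g hy'
      rw [hτ, ← Category.assoc] at h1
      rcases hUaut τ h1 (hUres g hy) with h2 | h2
      · refine HoldsLocally.of_forall fun W'' k => ?_
        change (k ≫ g) ≫ y ≫ q = (k ≫ g) ≫ y' ≫ q
        have h3 : g ≫ y' ≫ q = g ≫ y ≫ q := by
          rw [← Category.assoc, hτ, Category.assoc, Category.assoc, hq τ h2]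
        rw [Category.assoc, Category.assoc, h3]
      · exact holdsLocally_of_bot_mem h2)
    ((hP (⊤_ C)).mono fun W f ⟨y, hy⟩ => ⟨_, y, hy, rfl⟩)
  have hS : S = ⊤ := eq_top_of_section F Y S e
  have ha : ∀ τ, a τ = a 1 := fun τ => by
    have : τ ∈ S := hS ▸ Subgroup.mem_top τ
    rw [this 1, one_mul]
  refine ⟨a 1, Sheaf.eq_of_locally_eq_grp X ?_⟩
  refine (hP Y).bind fun W f ⟨y, hy⟩ =>
    (locally_eq_comp_aut F hcop Y y f).mono fun W' g ⟨τ, hτ⟩ => ?_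
  rw [map_constSection, hτ, ← Category.assoc, hUres g hy τ, ha τ]

end ConstAtGalois

/-! ### Torsors: simple transitivity and morphisms -/

section Torsors

variable {C : Type u} [SmallCategory C] {J : GrothendieckTopology C}

namespace GSheaf

variable {G K : Sheaf J GrpCat.{u}}

theorem map_comp_apply (X : GSheaf G) {V V' V'' : C} (f : V' ⟶ V) (g : V'' ⟶ V')
    (x : X.carrier.obj.obj (op V)) :
    X.carrier.obj.map (g ≫ f).op x = X.carrier.obj.map g.op (X.carrier.obj.map f.op x) :=
  Functor.map_comp_apply X.carrier.obj f.op g.op x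

theorem IsTorsor.locally_nonempty {X : GSheaf G} (hX : IsTorsor X) (V : C) :
    HoldsLocally J fun W (_ : W ⟶ V) => Nonempty (X.carrier.obj.obj (op W)) := by
  obtain ⟨U, hU, ⟨t⟩⟩ := hX
  have h : HoldsLocally J fun W (_ : W ⟶ V) => Nonempty (U.obj.obj (op W)) :=
    (epi_terminal_iff U).1 hU V
  exact h.mono fun W f ⟨b⟩ => ⟨((t.equiv _).symm (1, b)).1⟩

/-- A trivialization turns the action locally into left multiplication, where one can cancel. -/
theorem IsTorsor.smul_left_injective {X : GSheaf G} (hX : IsTorsor X) {V : C}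
    (x : X.carrier.obj.obj (op V)) : Function.Injective fun g => X.smul (op V) g x := by
  obtain ⟨U, hU, ⟨t⟩⟩ := hX
  intro g g' e
  have h : HoldsLocally J fun W (_ : W ⟶ V) => Nonempty (U.obj.obj (op W)) :=
    (epi_terminal_iff U).1 hU V
  refine Sheaf.eq_of_locally_eq_grp G (h.mono fun W f ⟨b⟩ => ?_)
  have e' := congrArg (X.carrier.obj.map f.op) e
  simp only [X.map_smul] at e'
  have h1 := congrArg (fun y => (t.equiv _ (y, b)).1) e'
  simp only [t.equiv_smul] at h1
  exact mul_right_cancel h1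

/-- Locally the quotient of the coordinates of y and x in a trivialization works; freeness makes it
unique, so the local solutions glue. -/
theorem IsTorsor.exists_smul_eq {X : GSheaf G} (hX : IsTorsor X) {V : C}
    (x y : X.carrier.obj.obj (op V)) : ∃ g, X.smul (op V) g x = y := by
  have hinj := fun W x => hX.smul_left_injective (V := W) x
  obtain ⟨U, hU, ⟨t⟩⟩ := hX
  have h : HoldsLocally J fun W (_ : W ⟶ V) => Nonempty (U.obj.obj (op W)) :=
    (epi_terminal_iff U).1 hU V
  have hloc : HoldsLocally J fun W (f : W ⟶ V) =>
      ∃ g, X.smul (op W) g (X.carrier.obj.map f.op x) = X.carrier.obj.map f.op y :=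
    h.mono fun W f ⟨b⟩ => by
      refine ⟨(t.equiv (op W) (X.carrier.obj.map f.op y, b)).1 *
        (t.equiv (op W) (X.carrier.obj.map f.op x, b)).1⁻¹,
        congrArg Prod.fst ((t.equiv (op W)).injective (a₁ := (_, b)) (a₂ := (_, b)) ?_)⟩
      rw [t.equiv_smul, inv_mul_cancel_right]
      exact Prod.ext rfl (t.snd_equiv _ _ _).symm
  obtain ⟨g, hg⟩ := Sheaf.exists_glue_grp G
    (fun W f g => X.smul (op W) g (X.carrier.obj.map f.op x) = X.carrier.obj.map f.op y)
    (fun W f g hg W' k => by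
      rw [X.map_comp_apply, X.map_comp_apply, ← hg, X.map_smul])
    (fun W f g g' hg hg' => hinj W _ (hg.trans hg'.symm)) hloc
  refine ⟨g, Sheaf.eq_of_locally_eq X.carrier (hloc.mono fun W f ⟨g', hg'⟩ => ?_)⟩
  rw [X.map_smul, hg f g' hg', hg']

/-- An equivariant map which is bijective on sections is an isomorphism. -/
def isoOfBijective {X Y : GSheaf G} (f : X ⟶ Y)
    (hf : ∀ V, Function.Bijective (f.hom.hom.app V)) : X ≅ Y :=
  let e := fun V => Equiv.ofBijective (f.hom.hom.app V) (hf V)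
  have he : ∀ V y, f.hom.hom.app V ((e V).symm y) = y := fun V y => (e V).apply_symm_apply y
  { hom := f
    inv :=
      { hom := ObjectProperty.homMk
          { app := fun V => TypeCat.ofHom (e V).symm
            naturality := fun V W g => ConcreteCategory.hom_ext _ _ fun y => (hf W).1 <| by
              change f.hom.hom.app W ((e W).symm (Y.carrier.obj.map g y)) =
                f.hom.hom.app W (X.carrier.obj.map g ((e V).symm y))
              rw [he, NatTrans.naturality_apply, he] }
        map_smul := fun V g y => (hf V).1 <| by
          change f.hom.hom.app V ((e V).symm (Y.smul V g y)) =
            f.hom.hom.app V (X.smul V g ((e V).symm y))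
          rw [he, f.map_smul, he] }
    hom_inv_id := Hom.ext (ObjectProperty.hom_ext _ (NatTrans.ext (funext fun V =>
      ConcreteCategory.hom_ext _ _ fun x => (e V).symm_apply_apply x)))
    inv_hom_id := Hom.ext (ObjectProperty.hom_ext _ (NatTrans.ext (funext fun V =>
      ConcreteCategory.hom_ext _ _ fun x => he V x))) }

/-- Freeness on Y gives injectivity. Preimages exist locally by transitivity on Y and glue because
they are unique. -/
theorem IsTorsor.bijective_app {X Y : GSheaf G} (hX : IsTorsor X) (hY : IsTorsor Y) (f : X ⟶ Y)
    (V : Cᵒᵖ) : Function.Bijective (f.hom.hom.app V) := by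
  have hinj : ∀ V, Function.Injective (f.hom.hom.app V) := by
    intro V x x' e
    obtain ⟨g, rfl⟩ := hX.exists_smul_eq (V := V.unop) x x'
    have h1 : Y.smul V g (f.hom.hom.app V x) = Y.smul V 1 (f.hom.hom.app V x) := by
      rw [Y.one_smul, ← f.map_smul]
      exact e.symm
    rw [show g = 1 from hY.smul_left_injective (V := V.unop) _ h1]
    exact (X.one_smul V x).symm
  refine ⟨hinj V, fun y => ?_⟩
  have hloc : HoldsLocally J fun W (k : W ⟶ V.unop) =>
      ∃ x, f.hom.hom.app (op W) x = Y.carrier.obj.map k.op y :=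
    (hX.locally_nonempty V.unop).mono fun W k ⟨x⟩ => by
      obtain ⟨g, hg⟩ := hY.exists_smul_eq (f.hom.hom.app (op W) x) (Y.carrier.obj.map k.op y)
      exact ⟨X.smul _ g x, by rw [f.map_smul, hg]⟩
  obtain ⟨x, hx⟩ := Sheaf.exists_glue X.carrier (V := V.unop)
    (fun W k x => f.hom.hom.app (op W) x = Y.carrier.obj.map k.op y)
    (fun W k x hx W' l => by
      rw [Y.map_comp_apply, ← hx, NatTrans.naturality_apply])
    (fun W k x x' hx hx' => hinj _ (hx.trans hx'.symm)) hloc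
  refine ⟨x, Sheaf.eq_of_locally_eq Y.carrier (V := V.unop) (hloc.mono fun W k ⟨x', hx'⟩ => ?_)⟩
  rw [← hx', ← hx k x' hx', NatTrans.naturality_apply]

end GSheaf

/-! ### Classes of torsors, restriction and change of group -/

section Classes

variable {G K : Sheaf J GrpCat.{u}}

/-- The class of a torsor. -/
def H1.mk (X : GSheaf G) (hX : GSheaf.IsTorsor X) : H1 G :=
  Quotient.mk (isIsomorphicSetoid (SheafTorsor G)) ⟨X, hX⟩

theorem H1.exists_rep (x : H1 G) : ∃ X hX, x = H1.mk X hX :=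
  Quotient.inductionOn x fun P => ⟨P.obj, P.property, rfl⟩

/-- Every equivariant map of torsors is an isomorphism, so equalities of classes need only a map in
one direction. -/
theorem H1.mk_eq_mk_iff {X X' : GSheaf G} (hX : GSheaf.IsTorsor X) (hX' : GSheaf.IsTorsor X') :
    H1.mk X hX = H1.mk X' hX' ↔ Nonempty (X ⟶ X') := by
  constructor
  · intro h
    obtain ⟨e⟩ := Quotient.exact h
    exact ⟨e.hom.hom⟩
  · rintro ⟨f⟩
    let e := GSheaf.isoOfBijective f (hX.bijective_app hX' f)
    exact Quotient.sound ⟨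
      { hom := ObjectProperty.homMk e.hom
        inv := ObjectProperty.homMk e.inv
        hom_inv_id := ObjectProperty.hom_ext _ e.hom_inv_id
        inv_hom_id := ObjectProperty.hom_ext _ e.inv_hom_id }⟩

/-- The restriction of a torsor `X` to `Y` is trivial if and only if `X` has a section
over `Y`. -/
theorem H1.restrict_mk_eq_base_iff (Y : C) {X : GSheaf G} (hX : GSheaf.IsTorsor X) :
    H1.restrict G Y (H1.mk X hX) = H1.base (G.over Y) ↔
      Nonempty (X.carrier.obj.obj (op Y)) := by
  have key : H1.restrict G Y (H1.mk X hX) = H1.base (G.over Y) ↔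
      Nonempty (GSheaf.trivial (G.over Y) ⟶ X.restrict Y) :=
    eq_comm.trans (H1.mk_eq_mk_iff (GSheaf.trivial_isTorsor _) (GSheaf.restrict_isTorsor hX Y))
  rw [key]
  constructor
  · rintro ⟨f⟩
    exact ⟨f.hom.hom.app (op (Over.mk (𝟙 Y))) (1 : G.obj.obj (op Y))⟩
  · rintro ⟨p⟩
    exact ⟨
      { hom := ObjectProperty.homMk
          { app := fun V => TypeCat.ofHom fun g : G.obj.obj (op V.unop.left) =>
              X.smul (op V.unop.left) g (X.carrier.obj.map V.unop.hom.op p)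
            naturality := fun V W f => ConcreteCategory.hom_ext _ _ fun g => by
              refine Eq.trans ?_ (X.map_smul f.unop.left.op g _).symm
              rw [← X.map_comp_apply, Over.w]
              rfl }
        map_smul := fun V g h => X.mul_smul (op V.unop.left) g h _ }⟩

/-- Restriction commutes with change of the group. -/
theorem H1.restrict_map (φ : G ⟶ K) (Y : C) (x : H1 G) :
    H1.restrict K Y (H1.map φ x) =
      H1.map ((J.overPullback GrpCat.{u} Y).map φ) (H1.restrict G Y x) := by
  obtain ⟨X, hX, rfl⟩ := H1.exists_rep x
  refine (H1.mk_eq_mk_iff (GSheaf.restrict_isTorsor (GSheaf.push_isTorsor φ hX) Y)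
    (GSheaf.push_isTorsor _ (GSheaf.restrict_isTorsor hX Y))).2 ⟨?_⟩
  -- A section of the pushforward is a map defined on all objects over V.left; the comparison
  -- evaluates it on those coming from C/Y.
  exact
    { hom := ObjectProperty.homMk
        { app := fun V => TypeCat.ofHom fun s => ⟨homToGrp.mk
            (fun W x => homToGrp.eval s.1 (Over.mk W.hom.left) x)
            (fun {W W'} f x => homToGrp.eval_map s.1
              (Over.homMk f.left.left (congrArg (fun k => k.left) (Over.w f)) :
                Over.mk W'.hom.left ⟶ Over.mk W.hom.left) x),
            fun W g x => s.2 (Over.mk W.hom.left) g x⟩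
          naturality := fun V V' f => ConcreteCategory.hom_ext _ _ fun s =>
            Subtype.ext (homToGrp.ext fun W x => rfl) }
      map_smul := fun V k s => Subtype.ext (homToGrp.ext fun W x => rfl) }

end Classes

end Torsors

/-! ### Torsors twisted by a homomorphism Aut Y → H -/

section Twisted

open PreGaloisCategory

variable {C : Type u} [SmallCategory C] {J : GrothendieckTopology C} {Y : C}

/-- `X` has a section over `Y` on which the automorphisms of `Y` act through `θ`. -/
def GSheaf.IsTwist {H : Type u} [Group H] (X : GSheaf (constGrp J H)) (θ : Aut Y →* H) : Prop :=
  ∃ p : X.carrier.obj.obj (op Y), ∀ σ : Aut Y,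
    X.carrier.obj.map σ.hom.op p = X.smul (op Y) (constSection J (op Y) (θ σ)) p

theorem GSheaf.IsTwist.of_hom {H : Type u} [Group H] {X X' : GSheaf (constGrp J H)}
    {θ : Aut Y →* H} (h : X.IsTwist θ) (f : X ⟶ X') : X'.IsTwist θ := by
  obtain ⟨p, hp⟩ := h
  refine ⟨f.hom.hom.app (op Y) p, fun σ => ?_⟩
  rw [← f.map_smul, ← hp, NatTrans.naturality_apply]

theorem GSheaf.trivial_isTwist {H : Type u} [Group H] :
    (GSheaf.trivial (constGrp J H)).IsTwist (1 : Aut Y →* H) := by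
  refine ⟨(1 : (constGrp J H).obj.obj (op Y)), fun σ => ?_⟩
  change (constGrp J H).obj.map σ.hom.op 1 = constSection J (op Y) 1 * 1
  rw [map_one, map_one, mul_one]

/-- The class [1, p] is sent by σ to [1, θ(σ)p] = φ(θ(σ))[1, p]. -/
theorem GSheaf.IsTwist.push {H K : Type u} [Group H] [Group K] {X : GSheaf (constGrp J H)}
    (hX : IsTorsor X) {θ : Aut Y →* H} (h : X.IsTwist θ) (φ : H →* K) :
    (X.push (constGrpMap J φ)).IsTwist (φ.comp θ) := by
  obtain ⟨p, hp⟩ := h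
  choose d hd using fun (V : C) (x x' : X.carrier.obj.obj (op V)) => hX.exists_smul_eq x x'
  have hd' : ∀ {V : C} (x : X.carrier.obj.obj (op V)) (g : (constGrp J H).obj.obj (op V)),
      d V x (X.smul _ g x) = g := fun x g => hX.smul_left_injective x (hd _ _ _)
  let φ' := (constGrpMap J φ).hom
  have hφ : ∀ {V : C} (h : H), φ'.app (op V) (constSection J (op V) h) =
      constSection J (op V) (φ h) := fun h => constGrpMap_constSection φ _ h
  -- With d the difference of two sections of X, the class [1, p] is the map sending x = d·p to
  -- φ(d)⁻¹.
  refine ⟨⟨homToGrp.mk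
    (fun W x => (φ'.app _ (d W.left (X.carrier.obj.map W.hom.op p) x))⁻¹) ?_, ?_⟩,
    fun σ => Subtype.ext (homToGrp.ext fun W x => ?_)⟩
  · intro W W' f x
    rw [map_inv, ← NatTrans.naturality_apply φ']
    congr 3
    refine hX.smul_left_injective (X.carrier.obj.map W'.hom.op p) ?_
    change X.smul _ (d _ _ _) _ = X.smul _ _ _
    rw [hd, ← Over.w f, X.map_comp_apply, ← X.map_smul, hd]
  · intro W g x
    change (φ'.app _ (d W.left (X.carrier.obj.map W.hom.op p) (X.smul _ g x)))⁻¹ =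
      (φ'.app _ (d W.left (X.carrier.obj.map W.hom.op p) x))⁻¹ * (φ'.app _ g)⁻¹
    rw [← mul_inv_rev, ← map_mul]
    congr 2
    refine hX.smul_left_injective (X.carrier.obj.map W.hom.op p) ?_
    change X.smul _ (d _ _ _) _ = X.smul _ _ _
    rw [hd, X.mul_smul, hd]
  · change (φ'.app _ (d W.left (X.carrier.obj.map (W.hom ≫ σ.hom).op p) x))⁻¹ =
      (constGrp J K).obj.map W.hom.op (constSection J (op Y) (φ (θ σ))) *
        (φ'.app _ (d W.left (X.carrier.obj.map W.hom.op p) x))⁻¹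
    rw [map_constSection, ← hφ, ← inv_inj, mul_inv_rev, inv_inv, inv_inv,
      eq_mul_inv_iff_mul_eq, ← map_mul]
    congr 1
    refine hX.smul_left_injective (X.carrier.obj.map W.hom.op p) ?_
    change X.smul _ (_ * _) _ = X.smul _ (d _ _ _) _
    rw [X.mul_smul, hd, ← map_constSection (J := J) W.hom.op (θ σ), ← X.map_smul, ← hp,
      ← X.map_comp_apply, hd]

/-- Two torsors twisted by the same homomorphism are isomorphic. -/
theorem GSheaf.IsTwist.nonempty_hom {H : Type u} [Group H] {X X' : GSheaf (constGrp J H)}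
    (hX : IsTorsor X)
    (haut : ∀ {V : C} (y y' : V ⟶ Y),
      HoldsLocally J fun _ f => ∃ σ : Aut Y, f ≫ y' = f ≫ y ≫ σ.hom)
    (hY : ∀ V : C, HoldsLocally J fun W (_ : W ⟶ V) => Nonempty (W ⟶ Y))
    {θ : Aut Y →* H} (h : X.IsTwist θ) (h' : X'.IsTwist θ) : Nonempty (X ⟶ X') := by
  obtain ⟨p, hp⟩ := h
  obtain ⟨p', hp'⟩ := h'
  have hloc : ∀ {V : C} (x : X.carrier.obj.obj (op V)), HoldsLocally J fun W f =>
      ∃ (y : W ⟶ Y) (g : (constGrp J H).obj.obj (op W)),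
        X.carrier.obj.map f.op x = X.smul (op W) g (X.carrier.obj.map y.op p) := fun {V} x =>
    (hY V).mono fun W f ⟨y⟩ => by
      obtain ⟨g, hg⟩ := hX.exists_smul_eq (X.carrier.obj.map y.op p) (X.carrier.obj.map f.op x)
      exact ⟨y, g, hg.symm⟩
  -- The map is g·y^*p ↦ g·y^*p'. Another choice of y is locally y ≫ σ, which alters g by the same
  -- factor θ(σ) on both sides.
  have hglue : ∀ (V : C) (x : X.carrier.obj.obj (op V)), ∃ x' : X'.carrier.obj.obj (op V),
      ∀ {W : C} (f : W ⟶ V) (y : W ⟶ Y) (g : (constGrp J H).obj.obj (op W)),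
        X.carrier.obj.map f.op x = X.smul (op W) g (X.carrier.obj.map y.op p) →
        X'.carrier.obj.map f.op x' = X'.smul (op W) g (X'.carrier.obj.map y.op p') := by
    intro V x
    obtain ⟨x', hx'⟩ := Sheaf.exists_glue X'.carrier (V := V)
      (fun W f z => ∃ (y : W ⟶ Y) (g : (constGrp J H).obj.obj (op W)),
        X.carrier.obj.map f.op x = X.smul (op W) g (X.carrier.obj.map y.op p) ∧
        z = X'.smul (op W) g (X'.carrier.obj.map y.op p'))
      (by
        rintro W f _ ⟨y, g, hg, rfl⟩ W' k
        refine ⟨k ≫ y, (constGrp J H).obj.map k.op g, ?_, ?_⟩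
        · rw [X.map_comp_apply, hg, X.map_smul, X.map_comp_apply]
        · rw [X'.map_smul, X'.map_comp_apply])
      (by
        rintro W f _ _ ⟨y₁, g₁, h₁, rfl⟩ ⟨y₂, g₂, h₂, rfl⟩
        refine Sheaf.eq_of_locally_eq X'.carrier ((haut y₁ y₂).mono fun W' k ⟨σ, hσ⟩ => ?_)
        have e : ∀ (Z : GSheaf (constGrp J H)) (q : Z.carrier.obj.obj (op Y))
            (_ : ∀ σ : Aut Y, Z.carrier.obj.map σ.hom.op q =
              Z.smul (op Y) (constSection J (op Y) (θ σ)) q),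
            Z.carrier.obj.map k.op (Z.smul (op W) g₂ (Z.carrier.obj.map y₂.op q)) =
              Z.smul (op W') ((constGrp J H).obj.map k.op g₂ * constSection J (op W') (θ σ))
                (Z.carrier.obj.map (k ≫ y₁).op q) := by
          intro Z q hq
          rw [Z.map_smul, ← Z.map_comp_apply, hσ, ← Category.assoc, Z.map_comp_apply _ (k ≫ y₁), hq,
            Z.map_smul, map_constSection, Z.mul_smul]
        have h3 := congrArg (X.carrier.obj.map k.op) (h₁.symm.trans h₂)
        rw [e X p hp, X.map_smul, ← X.map_comp_apply] at h3
        rw [e X' p' hp', X'.map_smul, ← X'.map_comp_apply, ← hX.smul_left_injective _ h3])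
      ((hloc x).mono fun W f ⟨y, g, hg⟩ => ⟨_, y, g, hg, rfl⟩)
    exact ⟨x', fun f y g hg => hx' f _ ⟨y, g, hg, rfl⟩⟩
  choose m hm using hglue
  exact ⟨
    { hom := ObjectProperty.homMk
        { app := fun V => TypeCat.ofHom fun x => m V.unop x
          naturality := fun V W k => ConcreteCategory.hom_ext _ _ fun x => by
            refine Sheaf.eq_of_locally_eq X'.carrier ((hloc (X.carrier.obj.map k x)).mono
              fun Z f ⟨y, g, hg⟩ => ?_)
            refine (hm _ _ f y g hg).trans ?_
            refine Eq.trans ?_ (X'.map_comp_apply k.unop f (m V.unop x))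
            exact (hm V.unop x _ y g ((X.map_comp_apply k.unop f x).trans hg)).symm }
      map_smul := fun V a x => by
        refine Sheaf.eq_of_locally_eq X'.carrier ((hloc x).mono fun Z f ⟨y, g, hg⟩ => ?_)
        refine (hm _ _ f y ((constGrp J H).obj.map f.op a * g) ?_).trans ?_
        · rw [X.map_smul, hg, X.mul_smul]
        · refine Eq.trans ?_ (X'.map_smul f.op a _).symm
          rw [X'.mul_smul]
          exact congrArg _ (hm _ x f y g hg).symm }⟩

/-- Two homomorphisms twisting the same torsor are conjugate. -/
theorem GSheaf.IsTwist.conj {H : Type u} [Group H] {X : GSheaf (constGrp J H)} (hX : IsTorsor X)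
    (hc : Function.Bijective (constSection J (H := H) (op Y)))
    {θ θ' : Aut Y →* H} (h : X.IsTwist θ) (h' : X.IsTwist θ') :
    ∃ b : H, ∀ σ, θ' σ = b⁻¹ * θ σ * b := by
  obtain ⟨p, hp⟩ := h
  obtain ⟨p', hp'⟩ := h'
  obtain ⟨g, rfl⟩ := hX.exists_smul_eq p' p
  -- Now p = b·p' with b in H; computing σ^*p in two ways gives bθ'(σ) = θ(σ)b.
  obtain ⟨b, rfl⟩ := hc.2 g
  refine ⟨b, fun σ => ?_⟩
  have h1 := hp σ
  rw [X.map_smul, map_constSection, hp', ← X.mul_smul, ← X.mul_smul] at h1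
  have h2 := hX.smul_left_injective p' h1
  rw [mul_assoc, eq_inv_mul_iff_mul_eq]
  exact hc.1 (by rw [map_mul, map_mul]; exact h2)

/-- A torsor with a section over `Y` is a twist, if the sections of `H` over `Y` are constant. -/
theorem GSheaf.exists_isTwist {H : Type u} [Group H] {X : GSheaf (constGrp J H)}
    (hX : IsTorsor X) (hc : Function.Bijective (constSection J (H := H) (op Y)))
    (p : X.carrier.obj.obj (op Y)) : ∃ θ : Aut Y →* H, X.IsTwist θ := by
  have key : ∀ σ : Aut Y, ∃ h : H,
      X.carrier.obj.map σ.hom.op p = X.smul (op Y) (constSection J (op Y) h) p := by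
    intro σ
    obtain ⟨g, hg⟩ := hX.exists_smul_eq p (X.carrier.obj.map σ.hom.op p)
    obtain ⟨h, rfl⟩ := hc.2 g
    exact ⟨h, hg.symm⟩
  choose θ hθ using key
  -- Since στ has underlying morphism τ ≫ σ and τ^* fixes constants, (στ)^*p = τ^*(θ(σ)p) =
  -- θ(σ)θ(τ)p.
  refine ⟨MonoidHom.mk' θ fun σ τ => hc.1 (hX.smul_left_injective p ?_), p, hθ⟩
  change X.smul _ _ p = X.smul _ _ p
  rw [← hθ, map_mul, X.mul_smul, ← hθ, ← map_constSection (J := J) τ.hom.op, ← X.map_smul, ← hθ,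
    ← X.map_comp_apply]
  rfl

end Twisted

/-! ### The Galois object as a torsor under its automorphism group -/

section Universal

open PreGaloisCategory

variable {C : Type u} [SmallCategory C] [GaloisCategory C] {J : GrothendieckTopology C}

/-- A point in the fibre of V separates σ from τ, as automorphisms of a connected object act freely
on its fibre. If there is no point, V is initial, an empty coproduct, hence covered by the empty
family. -/
theorem aut_eq_or_bot_mem (F : C ⥤ FintypeCat.{w}) [FiberFunctor F]
    (hcop : FiniteCoproductsCover J) {Y : C} [PreGaloisCategory.IsConnected Y] {V : C}
    {y : V ⟶ Y} {σ τ : Aut Y} (h : y ≫ σ.hom = y ≫ τ.hom) : σ = τ ∨ ⊥ ∈ J V := by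
  by_cases hV : Nonempty (F.obj V)
  · obtain ⟨v⟩ := hV
    refine Or.inl (evaluation_aut_injective_of_isConnected F Y (F.map y v) ?_)
    have := congrArg (fun k => F.map k v) h
    simpa only [F.map_comp, ConcreteCategory.comp_apply] using this
  · obtain ⟨hi⟩ := (initial_iff_fiber_empty F V).2 (not_nonempty_iff.1 hV)
    refine Or.inr (J.superset_covering ?_ (hcop PEmpty (fun i => i.elim)
      (Cofan.mk V fun i => i.elim) ⟨Cofan.IsColimit.mk _ (fun s => hi.to s.pt) (fun _ j => j.elim)
        fun s m _ => hi.hom_ext _ _⟩))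
    rintro W _ ⟨_, _, _, ⟨i⟩, _⟩
    exact i.elim

/-- A Galois object covering the terminal sheaf is a torsor under the constant sheaf of its
automorphism group. -/
theorem exists_isTorsor_isTwist_id (F : C ⥤ FintypeCat.{w}) [FiberFunctor F] [J.Subcanonical]
    (hcop : FiniteCoproductsCover J) (Y : C) [IsGalois Y]
    (hY : Epi (terminal.from (J.yoneda.obj Y))) :
    ∃ X : GSheaf (constGrp J (Aut Y)), GSheaf.IsTorsor X ∧ X.IsTwist (MonoidHom.id (Aut Y)) := by
  let G := constGrp J (Aut Y)
  have haut := fun {V : C} => locally_eq_comp_aut (J := J) F hcop Y (V := V)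
  have hsep := fun {V : C} {y y' : V ⟶ Y} =>
    Sheaf.eq_of_locally_eq (J.yoneda.obj Y) (V := V) (z := y) (z' := y')
  -- A section g is locally a constant σ, and g·y is glued from the local morphisms y ≫ σ.
  have hact : ∀ (V : C) (g : G.obj.obj (op V)) (y : V ⟶ Y), ∃ y' : V ⟶ Y,
      ∀ {W : C} (f : W ⟶ V) (σ : Aut Y), G.obj.map f.op g = constSection J (op W) σ →
        f ≫ y' = f ≫ y ≫ σ.hom := by
    intro V g y
    obtain ⟨y', hy'⟩ := Sheaf.exists_glue (J.yoneda.obj Y) (V := V)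
      (fun W f z => ∃ σ : Aut Y, G.obj.map f.op g = constSection J (op W) σ ∧
        z = f ≫ y ≫ σ.hom)
      (by
        rintro W f _ ⟨σ, hσ, rfl⟩ W' k
        refine ⟨σ, ?_, (Category.assoc _ _ _).symm⟩
        rw [op_comp, Functor.map_comp_apply, hσ, map_constSection])
      (by
        rintro W f _ _ ⟨σ, hσ, rfl⟩ ⟨τ, hτ, rfl⟩
        by_cases h : σ = τ
        · rw [h]
        · exact hsep (holdsLocally_of_bot_mem
            (bot_mem_of_constSection_eq h (hσ.symm.trans hτ))))
      ((locally_constSection g).mono fun W f ⟨σ, hσ⟩ => ⟨_, σ, hσ, rfl⟩)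
    exact ⟨y', fun f σ hσ => hy' f _ ⟨σ, hσ, rfl⟩⟩
  choose act hact using hact
  let X : GSheaf G :=
    { carrier := J.yoneda.obj Y
      smul := fun V g y => act V.unop g y
      one_smul := fun V y => by
        have h := hact V.unop 1 y (𝟙 _) 1 (by rw [map_one, map_one])
        rw [Category.id_comp, Category.id_comp] at h
        exact h.trans (Category.comp_id y)
      mul_smul := fun V g h y => by
        refine hsep ((locally_constSection (V := V.unop) g).bind fun W f ⟨σ, hσ⟩ =>
          (locally_constSection (V := W) ((constGrp J (Aut Y)).obj.map f.op h)).mono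
            fun W' k ⟨τ, hτ⟩ => ?_)
        have hg : G.obj.map (k ≫ f).op g = constSection J (op W') σ := by
          rw [op_comp, Functor.map_comp_apply, hσ, map_constSection]
        have hh : G.obj.map (k ≫ f).op h = constSection J (op W') τ := by
          rw [op_comp, Functor.map_comp_apply, hτ]
        refine (hact V.unop (g * h) y (k ≫ f) (σ * τ) (by rw [map_mul, map_mul, hg, hh])).trans ?_
        refine Eq.trans ?_ (hact V.unop g (act V.unop h y) (k ≫ f) σ hg).symm
        rw [← Category.assoc _ _ σ.hom, hact V.unop h y (k ≫ f) τ hh, Category.assoc,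
          Category.assoc, Category.assoc, Category.assoc]
        rfl
      map_smul := fun {V W} f g y => by
        refine hsep ((locally_constSection (V := V.unop) g).pullback f.unop |>.mono
          fun W' k ⟨σ, hσ⟩ => ?_)
        have h1 := hact V.unop g y (k ≫ f.unop) σ hσ
        have h2 := hact W.unop (G.obj.map f g) (f.unop ≫ y) k σ
          (by rw [← hσ, op_comp, Functor.map_comp_apply]; rfl)
        refine (Category.assoc k f.unop (act V.unop g y)).symm.trans (h1.trans ?_)
        rw [Category.assoc, ← Category.assoc f.unop]
        exact h2.symm }
  -- Conversely y' is locally y ≫ σ, and these σ glue to the difference of y' and y.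
  have hdiff : ∀ {V : C} (y y' : V ⟶ Y), ∃ g : G.obj.obj (op V),
      ∀ {W : C} (f : W ⟶ V) (σ : Aut Y), f ≫ y' = f ≫ y ≫ σ.hom →
        G.obj.map f.op g = constSection J (op W) σ := by
    intro V y y'
    obtain ⟨g, hg⟩ := Sheaf.exists_glue_grp G (V := V)
      (fun W f g => ∃ σ : Aut Y, f ≫ y' = f ≫ y ≫ σ.hom ∧ g = constSection J (op W) σ)
      (by
        rintro W f _ ⟨σ, hσ, rfl⟩ W' k
        exact ⟨σ, by rw [Category.assoc, hσ, Category.assoc], map_constSection _ _⟩)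
      (by
        rintro W f _ _ ⟨σ, hσ, rfl⟩ ⟨τ, hτ, rfl⟩
        rw [← Category.assoc] at hσ hτ
        rcases aut_eq_or_bot_mem F hcop (hσ.symm.trans hτ) with h | h
        · rw [h]
        · exact Sheaf.eq_of_locally_eq_grp G (holdsLocally_of_bot_mem h))
      ((haut y y').mono fun W f ⟨σ, hσ⟩ => ⟨_, σ, hσ, rfl⟩)
    exact ⟨g, fun f σ hσ => hg f _ ⟨σ, hσ, rfl⟩⟩
  choose diff hdiff using @hdiff
  have hact_diff : ∀ {V : C} (y y' : V ⟶ Y), act V (diff y y') y = y' := fun y y' =>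
    hsep ((haut y y').mono fun W f ⟨σ, hσ⟩ =>
      (hact _ _ y f σ (hdiff y y' f σ hσ)).trans hσ.symm)
  have hdiff_act : ∀ {V : C} (y : V ⟶ Y) (g : G.obj.obj (op V)), diff y (act V g y) = g :=
    fun y g => Sheaf.eq_of_locally_eq_grp G ((locally_constSection g).mono fun W f ⟨σ, hσ⟩ =>
      (hdiff y _ f σ (hact _ g y f σ hσ)).trans hσ.symm)
  -- Y is trivialized along itself, (x, t) going to the difference of x and t together with t; the
  -- twisted section is the identity.
  refine ⟨X, ⟨J.yoneda.obj Y, hY, ⟨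
    { equiv := fun V =>
        { toFun := fun q => (diff (V := V.unop) q.2 q.1, q.2)
          invFun := fun q => (act V.unop q.1 q.2, q.2)
          left_inv := fun q => Prod.ext (hact_diff _ _) rfl
          right_inv := fun q => Prod.ext (hdiff_act _ _) rfl }
      snd_equiv := fun _ _ _ => rfl
      equiv_smul := fun V g x t => Prod.ext ?_ rfl
      equiv_map := fun {V W} f x t => Prod.ext ?_ rfl }⟩⟩, 𝟙 Y, fun σ => ?_⟩
  · change diff (V := V.unop) t (act V.unop g x) = g * diff (V := V.unop) t x
    have h : act V.unop (g * diff (V := V.unop) t x) t = act V.unop g x :=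
      (X.mul_smul V g _ t).trans (congrArg (act V.unop g) (hact_diff _ _))
    rw [← h, hdiff_act]
  · change diff (V := W.unop) (f.unop ≫ t) (f.unop ≫ x) = G.obj.map f (diff (V := V.unop) t x)
    have h : act W.unop (G.obj.map f (diff (V := V.unop) t x)) (f.unop ≫ t) = f.unop ≫ x :=
      (X.map_smul f _ t).symm.trans (congrArg (f.unop ≫ ·) (hact_diff _ _))
    rw [← h, hdiff_act]
  · have h := hact Y (constSection J (op Y) σ) (𝟙 Y) (𝟙 Y) σ (map_constSection _ _)
    rw [Category.id_comp, Category.id_comp, Category.id_comp] at h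
    exact (Category.comp_id _).trans h.symm

end Universal

end NonabSite

end

/-! ### The exact sequence -/

open NonabSite in
theorem mainTheorem11 {C : Type u} [SmallCategory C] [GaloisCategory C]
    (F : C ⥤ FintypeCat.{w}) [PreGaloisCategory.FiberFunctor F]
    (J : GrothendieckTopology C) [J.Subcanonical] (hcop : NonabSite.FiniteCoproductsCover J)
    (hconn : NonabSite.IsConnectedSite J)
    (Y : C) [PreGaloisCategory.IsGalois Y] (hY : Epi (terminal.from (J.yoneda.obj Y))) :
    ∃ α : ∀ (H : Type u) [Group H],
        NonabSite.GroupH1 (1 : Aut Y →* MulAut H) → NonabSite.H1 (NonabSite.constGrp J H),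
      -- exactness of the sequence of pointed sets and injectivity of the first map
      (∀ (H : Type u) [Group H],
        α H (NonabSite.GroupH1.base 1) = NonabSite.H1.base (NonabSite.constGrp J H) ∧
        NonabSite.H1.restrict (NonabSite.constGrp J H) Y (NonabSite.H1.base _) =
          NonabSite.H1.base ((NonabSite.constGrp J H).over Y) ∧
        Function.Injective (α H) ∧
        Set.range (α H) =
          {x | NonabSite.H1.restrict (NonabSite.constGrp J H) Y x = NonabSite.H1.base _}) ∧
      -- naturality in `H`
      (∀ (H K : Type u) [Group H] [Group K] (φ : H →* K),
        (∀ x, α K (NonabSite.GroupH1.map (ρ := 1) (σ := 1) φ (fun _ _ => rfl) x) =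
          NonabSite.H1.map (NonabSite.constGrpMap J φ) (α H x)) ∧
        (∀ x, NonabSite.H1.restrict (NonabSite.constGrp J K) Y
            (NonabSite.H1.map (NonabSite.constGrpMap J φ) x) =
          NonabSite.H1.map ((J.overPullback GrpCat.{u} Y).map (NonabSite.constGrpMap J φ))
            (NonabSite.H1.restrict (NonabSite.constGrp J H) Y x))) := by
  have hc : ∀ (H : Type u) [Group H], Function.Bijective (constSection J (H := H) (op Y)) :=
    fun H _ => ⟨constSection_injective Y, constSection_surjective F hcop hconn Y hY⟩
  have haut := fun {V : C} => locally_eq_comp_aut (J := J) F hcop Y (V := V)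
  have hloc := locally_nonempty_hom hY
  have hex : ∀ (H : Type u) [Group H] (θ : Aut Y →* H),
      ∃ X : GSheaf (constGrp J H), GSheaf.IsTorsor X ∧ X.IsTwist θ := by
    intro H _ θ
    obtain ⟨X, hX, h⟩ := exists_isTorsor_isTwist_id F hcop Y hY
    exact ⟨_, GSheaf.push_isTorsor _ hX, h.push hX θ⟩
  choose T hT hTθ using hex
  -- any torsor twisted by `θ` represents the class of `T θ`
  have hmk : ∀ {H : Type u} [Group H] {X : GSheaf (constGrp J H)} (hX : GSheaf.IsTorsor X)
      {θ : Aut Y →* H}, X.IsTwist θ → H1.mk (T H θ) (hT H θ) = H1.mk X hX := fun hX _ h =>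
    (H1.mk_eq_mk_iff _ _).2 ((hTθ _ _).nonempty_hom (hT _ _) haut hloc h)
  -- For the trivial action the cocycle identity is multiplicativity.
  let hom : ∀ {H : Type u} [Group H], GroupCocycle (1 : Aut Y →* MulAut H) → (Aut Y →* H) :=
    fun a => MonoidHom.mk' a.1 fun s t => a.2 s t
  have hconj : ∀ {H : Type u} [Group H] (a a' : GroupCocycle (1 : Aut Y →* MulAut H)),
      H1.mk _ (hT H (hom a)) = H1.mk _ (hT H (hom a')) ↔ (groupCohomologous 1) a a' := by
    intro H _ a a'
    constructor
    · intro h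
      obtain ⟨f⟩ := (H1.mk_eq_mk_iff _ _).1 h
      exact ((hTθ H (hom a)).of_hom f).conj (hT _ _) (hc H) (hTθ H (hom a'))
    · rintro ⟨b, hb⟩
      refine hmk _ ?_
      obtain ⟨p, hp⟩ := hTθ H (hom a')
      -- Translating p by b conjugates the twist: σ^*(bp) = b a'(σ)p = a(σ)bp.
      refine ⟨(T H (hom a')).smul _ (constSection J _ b) p, fun σ => ?_⟩
      have hb' : b * hom a' σ = hom a σ * b := by
        change b * a'.1 σ = a.1 σ * b
        rw [hb σ, mul_assoc, mul_inv_cancel_left]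
        rfl
      rw [GSheaf.map_smul, hp, map_constSection, ← GSheaf.mul_smul, ← GSheaf.mul_smul, ← map_mul,
        hb', map_mul]
  let α : ∀ (H : Type u) [Group H], GroupH1 (1 : Aut Y →* MulAut H) → H1 (constGrp J H) :=
    fun H _ => Quotient.lift (fun a => H1.mk _ (hT H (hom a))) fun a a' h => (hconj a a').2 h
  refine ⟨α, fun H _ => ⟨hmk (GSheaf.trivial_isTorsor _) GSheaf.trivial_isTwist, ?_, ?_, ?_⟩,
    fun H K _ _ φ => ⟨?_, fun x => H1.restrict_map _ Y x⟩⟩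
  · exact (H1.restrict_mk_eq_base_iff Y (GSheaf.trivial_isTorsor _)).2
      ⟨(1 : (constGrp J H).obj.obj (op Y))⟩
  · rintro ⟨a⟩ ⟨a'⟩ h
    exact Quotient.sound ((hconj a a').1 h)
  · ext x
    obtain ⟨X, hX, rfl⟩ := H1.exists_rep x
    refine Iff.trans ⟨?_, ?_⟩ (H1.restrict_mk_eq_base_iff Y hX).symm
    · rintro ⟨⟨a⟩, ha⟩
      obtain ⟨f⟩ := (H1.mk_eq_mk_iff _ _).1 ha
      obtain ⟨p, -⟩ := hTθ H (hom a)
      exact ⟨f.hom.hom.app _ p⟩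
    · rintro ⟨p⟩
      obtain ⟨θ, hθ⟩ := GSheaf.exists_isTwist hX (hc H) p
      exact ⟨Quotient.mk _ ⟨θ, map_mul θ⟩, hmk hX hθ⟩
  · rintro ⟨a⟩
    exact hmk (GSheaf.push_isTorsor _ (hT H (hom a))) ((hTθ H (hom a)).push (hT H _) φ)
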